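/- Let $p>0$ and $D=\{w\in\mathbb C: -\pi<\operatorname{Im}w<\pi\}$. Let $\mathcal W_p$ be the set of analytic functions $S:D\to\mathbb C$ such that $|\operatorname{Im}S(w)|\le\frac12\operatorname{Im}w$ whenever $0\le\operatorname{Im}w<\pi$, $S(0)=0$, and $S(-w)=S(w)$ and $S(w+p)=S(w)$ for all $w\in D$. Let $\mathcal B_p$ be the set of real-valued, odd, $p$-periodic $\Psi\in L^\infty(\mathbb R)$ with $\|\Psi\|_\infty\le\frac12$; elements of $L^\infty(\mathbb R)$ are identified when they are equal a.e., and oddness and periodicity are understood a.e. **(1)** If $\Psi\in\mathcal B_p$, then for every $w\in D$ the integral $$S_\Psi(w)=\frac12\int_{\mathbb R}\frac{\Psi(\lambda)\,\sinh(w/2)}{\cosh(\lambda/2)\cosh((w-\lambda)/2)}\,d\lambda$$ converges absolutely, and $S_\Psi\in\mathcal W_p$. **(2)** The map $\Psi\mapsto S_\Psi$ is a bijection from $\mathcal B_p$ onto $\mathcal W_p$. **(3)** If $S\in\mathcal W_p$ and $S=S_\Psi$ with $\Psi\in\mathcal B_p$, then $$\Psi(\lambda)=\frac1\pi\lim_{\mu\to\pi^-}\operatorname{Im}S(\lambda+i\mu)\qquad\text{for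 Lebesgue a.e. }\lambda\in\mathbb R.$$ **(4)** Let $c>1$ be the number with $p=2\log c$. Let $\mathcal M_c$ be the set of Molnár functions of type $c$: the analytic functions $f:\mathbb C\setminus(-\infty,0]\to\mathbb C$ such that $f(x)\ge0$ for $x>0$, $\operatorname{Im}f(z)\ge0$ if $\operatorname{Im}z>0$, $f(1)=1$, and $xf(1/x)=f(x)$ and $f(c^2x)=cf(x)$ for all $x>0$. With principal branches of $\log$ and $\sqrt{\cdot}$, the map $f\mapsto S_f$, $S_f(w)=\log f(e^w)-\frac w2$ ($w\in D$), is a bijection from $\mathcal M_c$ onto $\mathcal W_p$. For $\Psi\in\mathcal B_p$ put $$f_\Psi(z)=\sqrt z\,\exp\left\{(z-1)\int_{\mathbb R}\frac{\Psi(\lambda)}{(1+e^{\lambda})(1+e^{-\lambda}z)}\,d\lambda\right\},\qquad z\in\mathbb C\setminus(-\infty,0],$$ where the integral converges absolutely. Then $S_{f_\Psi}=S_\Psi$, and $\Psi\mapsto f_\Psi$ is a bijection from $\mathcal B_p$ onto $\mathcal M_c$. -/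

import Mathlib

open MeasureTheory Filter Topology

noncomputable section

/-- Real-valued functions in `L^∞(ℝ)`, modulo equality almost everywhere, with the essential
supremum norm. -/
abbrev RealLInfty : Type := Lp ℝ ⊤ (volume : Measure ℝ)

/-- The real-valued, odd, `p`-periodic `Ψ ∈ L^∞(ℝ)` with `‖Ψ‖_∞ ≤ 1/2`. -/
def oddPeriodicHalfBall (p : ℝ) : Set RealLInfty :=
  {Ψ | (∀ᵐ t : ℝ, Ψ (-t) = -Ψ t) ∧ (∀ᵐ t : ℝ, Ψ (t + p) = Ψ t) ∧ ‖Ψ‖ ≤ 1 / 2}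

/-- The open strip `D = {w : -π < Im w < π}`. -/
def strip : Set ℂ := {w | -Real.pi < w.im ∧ w.im < Real.pi}

/-- A function `U → ℂ`, viewed as a function on `ℂ` with the irrelevant value `0` outside `U`.
For open `U`, analyticity of the function on `U` is analyticity of this extension at each point
of `U`. -/
def extendZero {U : Set ℂ} (S : U → ℂ) : ℂ → ℂ := Function.extend Subtype.val S 0

/-- The conditions on an analytic function on the strip to be a `𝒲`-function with period `p`.
All the arguments at which `F` is evaluated lie in the strip. -/
structure IsWFunction (p : ℝ) (F : ℂ → ℂ) : Prop where
  analytic : AnalyticOnNhd ℂ F strip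
  abs_im_le : ∀ w : ℂ, 0 ≤ w.im → w.im < Real.pi → |(F w).im| ≤ w.im / 2
  map_zero : F 0 = 0
  even : ∀ w ∈ strip, F (-w) = F w
  periodic : ∀ w ∈ strip, F (w + p) = F w

/-- The class `𝒲_p` of functions `D → ℂ`. -/
def WClass (p : ℝ) : Set (strip → ℂ) := {S | IsWFunction p (extendZero S)}

/-- The integrand `Ψ(t) sinh(w/2) / (cosh(t/2) cosh((w-t)/2))`. -/
def stripIntegrand (Ψ : RealLInfty) (w : ℂ) (t : ℝ) : ℂ :=
  (Ψ t : ℂ) * Complex.sinh (w / 2) /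
    (Complex.cosh ((t : ℂ) / 2) * Complex.cosh ((w - t) / 2))

/-- The map `Ψ ↦ S`, with
`S(w) = (1/2) ∫ Ψ(t) sinh(w/2) / (cosh(t/2) cosh((w-t)/2)) dt` for `w ∈ D`. -/
def stripTransform (Ψ : RealLInfty) : strip → ℂ :=
  fun w => (1 / 2 : ℂ) * ∫ t : ℝ, stripIntegrand Ψ w t

/-- The conditions on an analytic function on `ℂ \ (-∞, 0]` to belong to `OM₊`. -/
structure IsOMPlus (F : ℂ → ℂ) : Prop where
  analytic : AnalyticOnNhd ℂ F Complex.slitPlane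
  nonneg : ∀ x : ℝ, 0 < x → 0 ≤ (F x).re ∧ (F x).im = 0
  im_nonneg : ∀ z : ℂ, 0 < z.im → 0 ≤ (F z).im

/-- The conditions to be a Molnár function of type `c` (where `c > 0`, `c ≠ 1`). -/
structure IsMolnarFunction (c : ℝ) (F : ℂ → ℂ) : Prop where
  omPlus : IsOMPlus F
  map_one : F 1 = 1
  symm : ∀ x : ℝ, 0 < x → (x : ℂ) * F ((1 / x : ℝ) : ℂ) = F x
  scaling : ∀ x : ℝ, 0 < x → F ((c ^ 2 * x : ℝ) : ℂ) = c * F x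

/-- The class `𝓜_c` of Molnár functions of type `c`, as functions `ℂ \ (-∞, 0] → ℂ`
(`Complex.slitPlane` is the complement of `(-∞, 0]`). -/
def MolnarClass (c : ℝ) : Set (Complex.slitPlane → ℂ) :=
  {f | IsMolnarFunction c (extendZero f)}

/-- The correspondence `f ↦ S_f`, `S_f(w) = log f(e^w) - w/2` for `w ∈ D`, with the principal
branch of the logarithm. For `w ∈ D` the point `e^w` is in `ℂ \ (-∞, 0]`. -/
def logTransform (f : Complex.slitPlane → ℂ) : strip → ℂ :=
  fun w => Complex.log (extendZero f (Complex.exp w)) - (w : ℂ) / 2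

/-- The integrand `Ψ(t) / ((1 + e^t)(1 + e^{-t} z))`. -/
def slitIntegrand (Ψ : RealLInfty) (z : ℂ) (t : ℝ) : ℂ :=
  (Ψ t : ℂ) / ((1 + Complex.exp t) * (1 + Complex.exp (-t) * z))

/-- The map `Ψ ↦ f`, with
`f(z) = √z exp((z - 1) ∫ Ψ(t) / ((1 + e^t)(1 + e^{-t} z)) dt)` for `z ∈ ℂ \ (-∞, 0]`, where
`√z = exp((log z)/2)` is the principal branch. -/
def molnarTransform (Ψ : RealLInfty) : Complex.slitPlane → ℂ :=
  fun z => Complex.exp (Complex.log z / 2) *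
    Complex.exp (((z : ℂ) - 1) * ∫ t : ℝ, slitIntegrand Ψ z t)

end

noncomputable section

/-! The addition formula splits the kernel as `tanh(t/2) + tanh((w-t)/2)`. At `w = x + iy` its
imaginary part is therefore `sin y / (cosh(x-t) + cos y)`, a Poisson kernel for the strip `0 < Im w
< π` with total mass `2y` (`stripKernel_im`, `integral_stripPoisson`). So `Im S_Ψ` is half a Poisson
integral of `Ψ`: it vanishes on the real line, is at most `y/2` in modulus, and has boundary values
`πΨ` on `Im w = π`. Fatou's theorem (`ae_tendsto_stripPotential_im`) gives the recovery formula,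
hence injectivity, and carries evenness and periodicity of `S` over to oddness and periodicity of
`Ψ`.

For surjectivity, take `F` in the class and dilate it: `F(rw)` with `r < 1` has continuous boundary
values on `Im w = π`, uniformly continuous because of periodicity. A Phragmén–Lindelöf argument
identifies it with the potential of those values (`dilate_eq_stripPotential`). The boundary
functions are bounded by `1/2`, so they have a weak limit point as `r → 1`. Passing to the limit on
the real axis and applying the identity theorem represents `F` (`exists_eqOn_stripPotential`).

For a Molnár function `f`, the function `log f(e^w) - w/2` is even and periodic because of the two
functional equations, and `Im f ≥ 0` together with evenness is the bound `y/2`. In the other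
direction the bound places the argument of `e^{w/2 + S(w)}` between `0` and `y`. The substitution `z
= e^w` turns the integral formula for `f_Ψ` into the one for `S_Ψ`. -/

/-- The kernel `sinh(w/2) / (cosh(t/2) cosh((w-t)/2))`. -/
def stripKernel (w : ℂ) (t : ℝ) : ℂ :=
  Complex.sinh (w / 2) / (Complex.cosh ((t : ℂ) / 2) * Complex.cosh ((w - t) / 2))

/-- The transform of an arbitrary function against `stripKernel`. -/
def stripPotential (ψ : ℝ → ℝ) (w : ℂ) : ℂ := (1 / 2 : ℂ) * ∫ t : ℝ, (ψ t : ℂ) * stripKernel w t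

/-- The Poisson kernel of the strip `{0 < Im w < π}` for the upper boundary line. -/
def stripPoisson (y s : ℝ) : ℝ := Real.sin y / (Real.cosh s + Real.cos y)

/-! ### The strip and integrability of the kernel. -/

theorem isOpen_strip : IsOpen strip :=
  (isOpen_lt continuous_const Complex.continuous_im).inter
    (isOpen_lt Complex.continuous_im continuous_const)

theorem convex_strip : Convex ℝ strip :=
  (convex_halfSpace_im_gt (-Real.pi)).inter (convex_halfSpace_im_lt Real.pi)

theorem zero_mem_strip : (0 : ℂ) ∈ strip := by
  simp [strip, Real.pi_pos]

theorem ofReal_mem_strip (x : ℝ) : (x : ℂ) ∈ strip := by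
  simp [strip, Real.pi_pos]

theorem neg_mem_strip {w : ℂ} (hw : w ∈ strip) : -w ∈ strip := by
  have h1 := hw.1
  have h2 := hw.2
  constructor <;> simp <;> linarith

theorem add_ofReal_mem_strip {w : ℂ} (hw : w ∈ strip) (x : ℝ) : w + x ∈ strip := by
  have h1 := hw.1
  have h2 := hw.2
  constructor <;> simp <;> linarith

theorem cos_half_pos_of_mem_strip {w : ℂ} (hw : w ∈ strip) : 0 < Real.cos (w.im / 2) :=
  Real.cos_pos_of_mem_Ioo ⟨by linarith [hw.1], by linarith [hw.2]⟩

theorem half_sub_eq (w : ℂ) (t : ℝ) :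
    (w - t) / 2 = (((w.re - t) / 2 : ℝ) : ℂ) + ((w.im / 2 : ℝ) : ℂ) * Complex.I := by
  apply Complex.ext <;> simp

theorem cosh_ofReal_add_mul_I (a b : ℝ) : Complex.cosh ((a : ℂ) + (b : ℂ) * Complex.I) =
    ⟨Real.cosh a * Real.cos b, Real.sinh a * Real.sin b⟩ := by
  rw [Complex.cosh_add, Complex.cosh_mul_I, Complex.sinh_mul_I, ← Complex.ofReal_cosh,
    ← Complex.ofReal_sinh, ← Complex.ofReal_cos, ← Complex.ofReal_sin]
  apply Complex.ext <;> simp [-Complex.ofReal_cosh, -Complex.ofReal_sinh, -Complex.ofReal_cos,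
    -Complex.ofReal_sin]

theorem sinh_ofReal_add_mul_I (a b : ℝ) : Complex.sinh ((a : ℂ) + (b : ℂ) * Complex.I) =
    ⟨Real.sinh a * Real.cos b, Real.cosh a * Real.sin b⟩ := by
  rw [Complex.sinh_add, Complex.cosh_mul_I, Complex.sinh_mul_I, ← Complex.ofReal_cosh,
    ← Complex.ofReal_sinh, ← Complex.ofReal_cos, ← Complex.ofReal_sin]
  apply Complex.ext <;> simp [-Complex.ofReal_cosh, -Complex.ofReal_sinh, -Complex.ofReal_cos,
    -Complex.ofReal_sin]

theorem re_cosh_half_sub (w : ℂ) (t : ℝ) :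
    (Complex.cosh ((w - t) / 2)).re = Real.cosh ((w.re - t) / 2) * Real.cos (w.im / 2) := by
  rw [half_sub_eq, cosh_ofReal_add_mul_I]

theorem cosh_mul_cos_le_norm_cosh_half_sub (w : ℂ) (t : ℝ) :
    Real.cosh ((w.re - t) / 2) * Real.cos (w.im / 2) ≤ ‖Complex.cosh ((w - t) / 2)‖ := by
  rw [← re_cosh_half_sub]
  exact Complex.re_le_norm _

theorem cosh_half_sub_ne_zero {w : ℂ} (hw : w ∈ strip) (t : ℝ) :
    Complex.cosh ((w - t) / 2) ≠ 0 := by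
  intro h
  have := re_cosh_half_sub w t
  rw [h] at this
  have h2 := mul_pos (Real.cosh_pos ((w.re - t) / 2)) (cos_half_pos_of_mem_strip hw)
  simp at this
  rcases this with h | h
  · exact (Real.cosh_pos _).ne' h
  · exact (cos_half_pos_of_mem_strip hw).ne' h

theorem cosh_half_ofReal_ne_zero (t : ℝ) : Complex.cosh ((t : ℂ) / 2) ≠ 0 := by
  have : (t : ℂ) / 2 = ((t / 2 : ℝ) : ℂ) := by simp
  rw [this, ← Complex.ofReal_cosh]
  exact_mod_cast (Real.cosh_pos _).ne'

theorem one_add_sq_le_cosh_sq (s : ℝ) : 1 + s ^ 2 ≤ Real.cosh s ^ 2 := by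
  rw [Real.cosh_sq]
  have : s ^ 2 ≤ Real.sinh s ^ 2 := by
    rw [sq_le_sq, Real.abs_sinh]
    exact Real.self_le_sinh_iff.2 (abs_nonneg s)
  linarith

/-- The centre `a` stays fixed while `x` moves, so one integrable majorant serves a whole
neighbourhood when differentiating under the integral. -/
theorem one_add_sq_le_eight_mul_cosh_half_sq {a x : ℝ} (t : ℝ) (h : |x - a| ≤ 1) :
    1 + (t - a) ^ 2 ≤ 8 * Real.cosh ((x - t) / 2) ^ 2 := by
  have h1 := one_add_sq_le_cosh_sq ((x - t) / 2)
  have h2 : (x - a) ^ 2 ≤ 1 := by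
    rw [← sq_abs]; nlinarith [abs_nonneg (x - a)]
  nlinarith [sq_nonneg ((t - x) - (x - a)), sq_nonneg (x - t)]

theorem integrable_inv_one_add_sub_sq (a : ℝ) : Integrable fun t : ℝ => (1 + (t - a) ^ 2)⁻¹ :=
  integrable_inv_one_add_sq.comp_sub_right a

theorem norm_inv_cosh_half_sub_sq_le {w : ℂ} (hw : w ∈ strip) {a : ℝ} (h : |w.re - a| ≤ 1)
    (t : ℝ) : ‖(Complex.cosh ((w - t) / 2) ^ 2)⁻¹‖ ≤
      8 * (Real.cos (w.im / 2) ^ 2)⁻¹ * (1 + (t - a) ^ 2)⁻¹ := by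
  have h0 := cos_half_pos_of_mem_strip hw
  have h1 := cosh_mul_cos_le_norm_cosh_half_sub w t
  have h2 := one_add_sq_le_eight_mul_cosh_half_sq t h
  have h3 : 0 < 1 + (t - a) ^ 2 := by positivity
  have h4 := pow_le_pow_left₀ (by have := Real.cosh_pos ((w.re - t) / 2); positivity) h1 2
  have h5 : (1 + (t - a) ^ 2) * Real.cos (w.im / 2) ^ 2 / 8 ≤
      ‖Complex.cosh ((w - t) / 2)‖ ^ 2 := by
    refine le_trans ?_ h4
    rw [mul_pow]
    nlinarith [pow_pos h0 2]
  rw [norm_inv, norm_pow]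
  calc (‖Complex.cosh ((w - t) / 2)‖ ^ 2)⁻¹
      ≤ ((1 + (t - a) ^ 2) * Real.cos (w.im / 2) ^ 2 / 8)⁻¹ :=
        inv_anti₀ (by positivity) h5
    _ = _ := by field_simp

theorem continuous_inv_cosh_half_sub {w : ℂ} (hw : w ∈ strip) :
    Continuous fun t : ℝ => (Complex.cosh ((w - t) / 2))⁻¹ :=
  Continuous.inv₀ (by fun_prop) (cosh_half_sub_ne_zero hw)

theorem integrable_inv_cosh_half_sub_sq {w : ℂ} (hw : w ∈ strip) :
    Integrable fun t : ℝ => (Complex.cosh ((w - t) / 2) ^ 2)⁻¹ := by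
  refine Integrable.mono' ((integrable_inv_one_add_sub_sq w.re).const_mul
    (8 * (Real.cos (w.im / 2) ^ 2)⁻¹)) ?_
    (ae_of_all _ (norm_inv_cosh_half_sub_sq_le hw (by simp)))
  exact (((continuous_inv_cosh_half_sub hw).pow 2).congr fun t => inv_pow _ _).aestronglyMeasurable

theorem memLp_inv_cosh_half_sub {w : ℂ} (hw : w ∈ strip) :
    MemLp (fun t : ℝ => (Complex.cosh ((w - t) / 2))⁻¹) 2 := by
  rw [memLp_two_iff_integrable_sq_norm (continuous_inv_cosh_half_sub hw).aestronglyMeasurable]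
  have := (integrable_inv_cosh_half_sub_sq hw).norm
  simpa [norm_inv, norm_pow] using this

/-- Cauchy–Schwarz: both factors are square integrable. -/
theorem integrable_inv_cosh_mul_cosh {w : ℂ} (hw : w ∈ strip) :
    Integrable fun t : ℝ =>
      (Complex.cosh ((t : ℂ) / 2) * Complex.cosh ((w - t) / 2))⁻¹ := by
  have h1 := memLp_inv_cosh_half_sub zero_mem_strip
  have h2 := MemLp.integrable_mul h1 (memLp_inv_cosh_half_sub hw)
  refine h2.congr (ae_of_all _ fun t => ?_)
  simp [neg_div, Complex.cosh_neg, mul_comm]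

theorem integrable_stripKernel {w : ℂ} (hw : w ∈ strip) : Integrable (stripKernel w) :=
  (integrable_inv_cosh_mul_cosh hw).const_mul (Complex.sinh (w / 2))

/-! ### Analyticity and symmetries of the potential. -/

theorem integrable_ofReal_mul {ψ : ℝ → ℝ} {C : ℝ} (hm : AEStronglyMeasurable ψ)
    (hb : ∀ᵐ t, |ψ t| ≤ C) {g : ℝ → ℂ} (hg : Integrable g) :
    Integrable fun t : ℝ => (ψ t : ℂ) * g t :=
  hg.bdd_mul (c := C) (Complex.continuous_ofReal.comp_aestronglyMeasurable hm)
    (hb.mono fun t ht => by simpa using ht)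

/-- The numerator of the quotient rule collapses to `cosh(t/2)` by the subtraction formula. The
derivative depends only on `w - t`, although the kernel does not. -/
theorem hasDerivAt_stripKernel {w : ℂ} (hw : w ∈ strip) (t : ℝ) :
    HasDerivAt (fun w => stripKernel w t) (1 / 2 * (Complex.cosh ((w - t) / 2) ^ 2)⁻¹) w := by
  have h1 := cosh_half_sub_ne_zero hw t
  have h2 := cosh_half_ofReal_ne_zero t
  have h3 : HasDerivAt (fun w : ℂ => Complex.sinh (w / 2)) (Complex.cosh (w / 2) * (1 / 2)) w :=
    (Complex.hasDerivAt_sinh _).comp w ((hasDerivAt_id w).div_const 2)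
  have h4 : HasDerivAt (fun w : ℂ => Complex.cosh ((w - t) / 2))
      (Complex.sinh ((w - t) / 2) * (1 / 2)) w :=
    (Complex.hasDerivAt_cosh _).comp w (((hasDerivAt_id w).sub_const (t : ℂ)).div_const 2)
  have h5 := h3.div (h4.const_mul (Complex.cosh ((t : ℂ) / 2))) (mul_ne_zero h2 h1)
  refine h5.congr_deriv ?_
  have key : Complex.cosh ((t : ℂ) / 2) = Complex.cosh (w / 2) * Complex.cosh ((w - t) / 2)
      - Complex.sinh (w / 2) * Complex.sinh ((w - t) / 2) := by
    rw [← Complex.cosh_sub]; congr 1; ring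
  field_simp
  linear_combination -key

theorem hasDerivAt_stripPotential {ψ : ℝ → ℝ} {C : ℝ} (hm : AEStronglyMeasurable ψ)
    (hb : ∀ᵐ t, |ψ t| ≤ C) {w : ℂ} (hw : w ∈ strip) :
    HasDerivAt (stripPotential ψ)
      (1 / 2 * ∫ t : ℝ, (ψ t : ℂ) * (1 / 2 * (Complex.cosh ((w - t) / 2) ^ 2)⁻¹)) w := by
  have h0 := cos_half_pos_of_mem_strip hw
  have hcont : ContinuousAt (fun z : ℂ => Real.cos (z.im / 2)) w := by fun_prop
  have hcos : ∀ᶠ z : ℂ in 𝓝 w, Real.cos (w.im / 2) / 2 < Real.cos (z.im / 2) :=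
    hcont.eventually (lt_mem_nhds (half_lt_self h0))
  have hre : ∀ᶠ z : ℂ in 𝓝 w, |z.re - w.re| ≤ 1 := by
    filter_upwards [Metric.closedBall_mem_nhds w one_pos] with z hz
    rw [← Complex.sub_re]
    exact (Complex.abs_re_le_norm _).trans (by rwa [mem_closedBall_iff_norm] at hz)
  have hs : {z | z ∈ strip ∧ Real.cos (w.im / 2) / 2 < Real.cos (z.im / 2) ∧
      |z.re - w.re| ≤ 1} ∈ 𝓝 w := by
    filter_upwards [isOpen_strip.mem_nhds hw, hcos, hre] with z h1 h2 h3 using ⟨h1, h2, h3⟩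
  refine (hasDerivAt_integral_of_dominated_loc_of_deriv_le
    (F := fun w t => (ψ t : ℂ) * stripKernel w t)
    (F' := fun w t => (ψ t : ℂ) * (1 / 2 * (Complex.cosh ((w - t) / 2) ^ 2)⁻¹))
    (bound := fun t => C * (8 * ((Real.cos (w.im / 2) / 2) ^ 2)⁻¹ * (1 + (t - w.re) ^ 2)⁻¹))
    hs ?_ ?_ ?_ ?_ ?_ ?_).2.const_mul (1 / 2)
  · filter_upwards [isOpen_strip.mem_nhds hw] with z hz
    exact (integrable_ofReal_mul hm hb (integrable_stripKernel hz)).1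
  · exact integrable_ofReal_mul hm hb (integrable_stripKernel hw)
  · exact (integrable_ofReal_mul hm hb ((integrable_inv_cosh_half_sub_sq hw).const_mul _)).1
  · filter_upwards [hb] with t ht z hz
    rw [norm_mul, norm_mul]
    have hC : 0 ≤ C := (abs_nonneg _).trans ht
    have h1 := norm_inv_cosh_half_sub_sq_le hz.1 hz.2.2 t
    have h2 : (Real.cos (z.im / 2) ^ 2)⁻¹ ≤ ((Real.cos (w.im / 2) / 2) ^ 2)⁻¹ :=
      inv_anti₀ (by positivity) (pow_le_pow_left₀ (by positivity) hz.2.1.le 2)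
    have h3 : 8 * (Real.cos (z.im / 2) ^ 2)⁻¹ * (1 + (t - w.re) ^ 2)⁻¹ ≤
        8 * ((Real.cos (w.im / 2) / 2) ^ 2)⁻¹ * (1 + (t - w.re) ^ 2)⁻¹ := by gcongr
    have h4 : ‖(1 / 2 : ℂ)‖ ≤ 1 := by norm_num
    calc ‖(ψ t : ℂ)‖ * (‖(1 / 2 : ℂ)‖ * ‖(Complex.cosh ((z - t) / 2) ^ 2)⁻¹‖)
        ≤ C * (1 * (8 * ((Real.cos (w.im / 2) / 2) ^ 2)⁻¹ * (1 + (t - w.re) ^ 2)⁻¹)) := by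
          gcongr
          · simpa using ht
          · exact h1.trans h3
      _ = _ := by ring
  · exact (((integrable_inv_one_add_sub_sq w.re).const_mul _).const_mul _)
  · refine ae_of_all _ fun t z hz => ?_
    exact (hasDerivAt_stripKernel hz.1 t).const_mul _

theorem analyticOnNhd_stripPotential {ψ : ℝ → ℝ} {C : ℝ} (hm : AEStronglyMeasurable ψ)
    (hb : ∀ᵐ t, |ψ t| ≤ C) : AnalyticOnNhd ℂ (stripPotential ψ) strip :=
  DifferentiableOn.analyticOnNhd
    (fun _ hw => (hasDerivAt_stripPotential hm hb hw).differentiableAt.differentiableWithinAt)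
    isOpen_strip

theorem stripPotential_zero (ψ : ℝ → ℝ) : stripPotential ψ 0 = 0 := by
  simp [stripPotential, stripKernel]

theorem stripKernel_neg (w : ℂ) (t : ℝ) : stripKernel (-w) (-t) = -stripKernel w t := by
  have : (-w - (-t : ℝ)) / 2 = -((w - t) / 2) := by push_cast; ring
  simp only [stripKernel, this]
  simp [neg_div, Complex.cosh_neg, Complex.sinh_neg]

theorem stripPotential_neg {ψ : ℝ → ℝ} (ho : ∀ᵐ t, ψ (-t) = -ψ t) (w : ℂ) :
    stripPotential ψ (-w) = stripPotential ψ w := by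
  unfold stripPotential
  rw [← integral_neg_eq_self]
  congr 1
  apply integral_congr_ae
  filter_upwards [ho] with t ht
  rw [stripKernel_neg, ht]
  push_cast
  ring

/-- The derivative of the potential is a convolution, hence periodic, so `S(w + p) - S(w)` is
constant. Evenness makes the constant zero: at `w = -p/2` the two points are `±p/2`. -/
theorem stripPotential_add_period {ψ : ℝ → ℝ} {C p : ℝ} (hm : AEStronglyMeasurable ψ)
    (hb : ∀ᵐ t, |ψ t| ≤ C) (ho : ∀ᵐ t, ψ (-t) = -ψ t) (hp : ∀ᵐ t, ψ (t + p) = ψ t) {w : ℂ}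
    (hw : w ∈ strip) : stripPotential ψ (w + p) = stripPotential ψ w := by
  have hderiv : ∀ z ∈ strip,
      HasDerivAt (fun z => stripPotential ψ (z + p) - stripPotential ψ z) 0 z := by
    intro z hz
    have h1 := (hasDerivAt_stripPotential hm hb (add_ofReal_mem_strip hz p)).comp_add_const z (p : ℂ)
    refine (h1.sub (hasDerivAt_stripPotential hm hb hz)).congr_deriv ?_
    rw [sub_eq_zero]
    congr 1
    rw [← integral_add_right_eq_self _ p]
    apply integral_congr_ae
    filter_upwards [hp] with t ht
    rw [ht]
    congr 5
    push_cast; ring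
  have hconst := convex_strip.is_const_of_fderivWithin_eq_zero (𝕜 := ℂ)
    (f := fun z => stripPotential ψ (z + p) - stripPotential ψ z)
    (fun z hz => (hderiv z hz).differentiableAt.differentiableWithinAt)
    (fun z hz => by
      rw [fderivWithin_of_isOpen isOpen_strip hz]
      have := (hderiv z hz).hasFDerivAt.fderiv
      rw [this]; ext; simp) hw (ofReal_mem_strip (-p / 2))
  have h2 : stripPotential ψ (((-p / 2 : ℝ) : ℂ) + p) = stripPotential ψ ((-p / 2 : ℝ) : ℂ) := by
    rw [← stripPotential_neg ho]; congr 1; push_cast; ring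
  simp only [h2, sub_self] at hconst
  exact sub_eq_zero.1 hconst

/-! ### The imaginary part as a Poisson integral. -/

theorem cosh_half_sub_normSq (w : ℂ) (t : ℝ) :
    Complex.normSq (Complex.cosh ((w - t) / 2)) =
      (Real.cosh (w.re - t) + Real.cos w.im) / 2 := by
  rw [half_sub_eq, cosh_ofReal_add_mul_I]
  have h1 : Real.cosh (w.re - t) = 2 * Real.cosh ((w.re - t) / 2) ^ 2 - 1 := by
    have := Real.cosh_two_mul ((w.re - t) / 2)
    rw [Real.sinh_sq] at this
    rw [show w.re - t = 2 * ((w.re - t) / 2) by ring, this]; ring_nf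
  have h2 : Real.cos w.im = 2 * Real.cos (w.im / 2) ^ 2 - 1 := by
    rw [← Real.cos_two_mul]; ring_nf
  have h3 := Real.sin_sq_add_cos_sq (w.im / 2)
  have h4 := Real.cosh_sq ((w.re - t) / 2)
  rw [Complex.normSq_apply, h1, h2]
  simp
  linear_combination Real.sinh ((w.re - t) / 2) ^ 2 * h3 - (1 - Real.cos (w.im / 2) ^ 2) * h4

/-- In the splitting `tanh(t/2) + tanh((w-t)/2)` the first term is real, so only the second, a
function of `w - t`, contributes. -/
theorem stripKernel_im {w : ℂ} (hw : w ∈ strip) (t : ℝ) :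
    (stripKernel w t).im = stripPoisson w.im (w.re - t) := by
  have h1 := cosh_half_sub_ne_zero hw t
  have h2 := cosh_half_ofReal_ne_zero t
  have hsum : stripKernel w t = Complex.sinh ((t : ℂ) / 2) / Complex.cosh ((t : ℂ) / 2)
      + Complex.sinh ((w - t) / 2) / Complex.cosh ((w - t) / 2) := by
    have : w / 2 = (t : ℂ) / 2 + (w - t) / 2 := by ring
    rw [stripKernel, this, Complex.sinh_add]
    field_simp
  have h3 : (Complex.sinh ((t : ℂ) / 2) / Complex.cosh ((t : ℂ) / 2)).im = 0 := by
    have : (t : ℂ) / 2 = ((t / 2 : ℝ) : ℂ) := by simp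
    rw [this, ← Complex.ofReal_cosh, ← Complex.ofReal_sinh, ← Complex.ofReal_div,
      Complex.ofReal_im]
  rw [hsum, Complex.add_im, h3, zero_add, Complex.div_im, stripPoisson,
    cosh_half_sub_normSq]
  have hpos : 0 < Real.cosh (w.re - t) + Real.cos w.im := by
    have := cosh_half_sub_normSq w t
    have h := Complex.normSq_pos.2 h1
    linarith
  have hS : Real.sin w.im = 2 * Real.sin (w.im / 2) * Real.cos (w.im / 2) := by
    rw [← Real.sin_two_mul]; ring_nf
  rw [half_sub_eq, cosh_ofReal_add_mul_I, sinh_ofReal_add_mul_I]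
  simp
  rw [hS]
  field_simp
  have h4 := Real.cosh_sq ((w.re - t) / 2)
  linear_combination Real.sin (w.im / 2) * Real.cos (w.im / 2) * h4

theorem stripPoisson_denom_pos {y : ℝ} (hy : |y| < Real.pi) (s : ℝ) :
    0 < Real.cosh s + Real.cos y := by
  have h1 := Real.one_le_cosh s
  have h2 : Real.cos Real.pi < Real.cos |y| :=
    Real.cos_lt_cos_of_nonneg_of_le_pi (abs_nonneg y) le_rfl hy
  rw [Real.cos_pi, Real.cos_abs] at h2
  linarith

theorem stripPoisson_nonneg {y : ℝ} (h0 : 0 ≤ y) (hy : y < Real.pi) (s : ℝ) :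
    0 ≤ stripPoisson y s :=
  div_nonneg (Real.sin_nonneg_of_nonneg_of_le_pi h0 hy.le)
    (stripPoisson_denom_pos (by rwa [abs_of_nonneg h0]) s).le

theorem stripPoisson_neg (y s : ℝ) : stripPoisson y (-s) = stripPoisson y s := by
  simp [stripPoisson]

theorem integrable_stripPoisson {y : ℝ} (h0 : 0 ≤ y) (hy : y < Real.pi) :
    Integrable (stripPoisson y) := by
  have hw : (y : ℂ) * Complex.I ∈ strip := by
    constructor <;> simp <;> linarith [Real.pi_pos]
  refine (integrable_stripKernel hw).im.congr (ae_of_all _ fun t => ?_)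
  have := stripKernel_im hw t
  simp at this
  simp [this, stripPoisson_neg]

theorem integral_stripPoisson {y : ℝ} (h0 : 0 ≤ y) (hy : y < Real.pi) :
    ∫ s, stripPoisson y s = 2 * y := by
  rcases h0.eq_or_lt with rfl | h0'
  · simp [stripPoisson]
  have hs : 0 < Real.sin y := Real.sin_pos_of_pos_of_lt_pi h0' hy
  -- The primitive comes from substituting `u = e^s`. Its limits at `-∞` and `+∞` are `π - 2y` and
  -- `π`.
  have hd : ∀ s : ℝ, HasDerivAt
      (fun s => 2 * Real.arctan ((Real.exp s + Real.cos y) / Real.sin y))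
      (stripPoisson y s) s := by
    intro s
    have h1 := ((((Real.hasDerivAt_exp s).add_const (Real.cos y)).div_const
      (Real.sin y)).arctan).const_mul 2
    refine h1.congr_deriv ?_
    have hpos := stripPoisson_denom_pos (y := y) (by rwa [abs_of_nonneg h0]) s
    rw [stripPoisson]
    rw [Real.cosh_eq, Real.exp_neg] at hpos ⊢
    have he := Real.exp_pos s
    have h3 : 0 < 1 + ((Real.exp s + Real.cos y) / Real.sin y) ^ 2 := by positivity
    have h4 := Real.sin_sq_add_cos_sq y
    have h5 : 0 < Real.exp s ^ 2 + 1 + 2 * Real.exp s * Real.cos y := by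
      have := mul_pos he hpos
      field_simp at this
      linarith
    field_simp
    linear_combination -h4
  have hbot : Tendsto (fun s => 2 * Real.arctan ((Real.exp s + Real.cos y) / Real.sin y)) atBot
      (𝓝 (2 * (Real.pi / 2 - y))) := by
    have h1 : Real.arctan ((0 + Real.cos y) / Real.sin y) = Real.pi / 2 - y := by
      rw [zero_add, ← Real.sin_pi_div_two_sub, ← Real.cos_pi_div_two_sub y,
        ← Real.tan_eq_sin_div_cos]
      exact Real.arctan_tan (by linarith) (by linarith)
    rw [← h1]
    exact ((Real.continuous_arctan.tendsto _).comp
      ((Real.tendsto_exp_atBot.add_const _).div_const _)).const_mul 2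
  have htop : Tendsto (fun s => 2 * Real.arctan ((Real.exp s + Real.cos y) / Real.sin y)) atTop
      (𝓝 (2 * (Real.pi / 2))) := by
    have h1 : Tendsto Real.arctan atTop (𝓝 (Real.pi / 2)) :=
      Real.tendsto_arctan_atTop.mono_right nhdsWithin_le_nhds
    exact (h1.comp ((tendsto_atTop_add_const_right _ _ Real.tendsto_exp_atTop).atTop_div_const
      hs)).const_mul 2
  rw [integral_of_hasDerivAt_of_tendsto hd (integrable_stripPoisson h0 hy) hbot htop]
  ring

theorem stripPotential_im {ψ : ℝ → ℝ} {C : ℝ} (hm : AEStronglyMeasurable ψ)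
    (hb : ∀ᵐ t, |ψ t| ≤ C) {w : ℂ} (hw : w ∈ strip) :
    (stripPotential ψ w).im = 1 / 2 * ∫ s, ψ (w.re - s) * stripPoisson w.im s := by
  have h1 := integral_im (integrable_ofReal_mul hm hb (integrable_stripKernel hw))
  have h2 : (stripPotential ψ w).im = 1 / 2 * (∫ t : ℝ, (ψ t : ℂ) * stripKernel w t).im := by
    rw [stripPotential, show (1 / 2 : ℂ) = ((1 / 2 : ℝ) : ℂ) by simp, Complex.im_ofReal_mul]
  rw [h2]
  congr 1
  rw [← integral_sub_left_eq_self (fun s => ψ (w.re - s) * stripPoisson w.im s) volume w.re]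
  refine h1.symm.trans (integral_congr_ae (ae_of_all _ fun t => ?_))
  simp [stripKernel_im hw]

/-! ### Fatou's theorem at the upper boundary. -/

/-- Off a neighbourhood of `0` the denominator is at least `s²/2`, so the factor `sin y` makes the
tail of the kernel vanish as `y → π`. -/
theorem stripPoisson_le_of_le_abs {y : ℝ} (h0 : 0 ≤ y) (hy : y < Real.pi) {δ s : ℝ} (hδ : 0 < δ)
    (hs : δ ≤ |s|) :
    stripPoisson y s ≤ Real.sin y * (2 * (1 + (δ ^ 2)⁻¹)) * (1 + s ^ 2)⁻¹ := by
  have h1 : δ ^ 2 ≤ s ^ 2 := by rw [← sq_abs s]; gcongr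
  have h2 : s ^ 2 / 2 ≤ Real.cosh s + Real.cos y := by
    have h3 := one_add_sq_le_cosh_sq (s / 2)
    have h4 := Real.cosh_two_mul (s / 2)
    rw [Real.sinh_sq, show 2 * (s / 2) = s by ring] at h4
    have := Real.neg_one_le_cos y
    nlinarith
  have h5 : 0 < s ^ 2 := lt_of_lt_of_le (by positivity) h1
  have h6 := Real.sin_nonneg_of_nonneg_of_le_pi h0 hy.le
  have h7 : 1 ≤ (δ ^ 2)⁻¹ * s ^ 2 := by
    rw [inv_mul_eq_div, le_div_iff₀ (by positivity)]; linarith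
  rw [stripPoisson, mul_assoc, div_eq_mul_inv]
  gcongr
  rw [inv_le_iff_one_le_mul₀ (by linarith)]
  calc (1 : ℝ) ≤ 2 * (1 + (δ ^ 2)⁻¹) * (1 + s ^ 2)⁻¹ * (s ^ 2 / 2) := by
        field_simp
        field_simp at h7
        nlinarith
    _ ≤ _ := by gcongr

/-- The kernel is even and decreasing in `|s|`, so its superlevel sets are centred intervals. This
lets bounds on means over balls control Poisson integrals. -/
theorem exists_setOf_lt_stripPoisson_inter_ball {y : ℝ} (h0 : 0 < y) (hy : y < Real.pi) {δ τ : ℝ}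
    (hδ : 0 < δ) (hτ : 0 < τ) :
    ∃ r, 0 ≤ r ∧ r ≤ δ ∧ {s | τ < stripPoisson y s} ∩ Metric.ball 0 δ = Metric.ball 0 r := by
  have key : ∀ s, τ < stripPoisson y s ↔ Real.cosh s < Real.sin y / τ - Real.cos y := by
    intro s
    have hpos := stripPoisson_denom_pos (y := y) (by rwa [abs_of_pos h0]) s
    rw [stripPoisson, lt_div_iff₀ hpos, lt_sub_iff_add_lt, lt_div_iff₀ hτ, mul_comm]
  rcases le_or_gt (Real.sin y / τ - Real.cos y) 1 with h | h
  · refine ⟨0, le_rfl, hδ.le, ?_⟩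
    ext s
    have := Real.one_le_cosh s
    simp only [Set.mem_inter_iff, Set.mem_ofPred_eq, key, Metric.ball_zero, Set.mem_empty_iff_false,
      iff_false, not_and]
    intro h'
    linarith
  · refine ⟨min (Real.arcosh (Real.sin y / τ - Real.cos y)) δ,
      le_min (Real.arcosh_nonneg h.le) hδ.le, min_le_right _ _, ?_⟩
    ext s
    simp only [Set.mem_inter_iff, Set.mem_ofPred_eq, key, mem_ball_zero_iff, Real.norm_eq_abs,
      lt_min_iff]
    conv_lhs => rw [← Real.cosh_arcosh h.le, Real.cosh_lt_cosh,
      abs_of_nonneg (Real.arcosh_nonneg h.le)]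

theorem continuous_stripPoisson {y : ℝ} (hy : |y| < Real.pi) : Continuous (stripPoisson y) :=
  continuous_const.div (by fun_prop) fun s => (stripPoisson_denom_pos hy s).ne'

theorem integrable_mul_stripPoisson {g : ℝ → ℝ} {M y : ℝ} (hg : AEStronglyMeasurable g)
    (hM : ∀ᵐ s, |g s| ≤ M) (h0 : 0 ≤ y) (hy : y < Real.pi) :
    Integrable fun s => g s * stripPoisson y s :=
  (integrable_stripPoisson h0 hy).bdd_mul (c := M) hg hM

/-- The Poisson integral of a bounded function is small near a point around which the means of the
function are small. -/
theorem integral_mul_stripPoisson_le {g : ℝ → ℝ} {M ε δ y : ℝ} (hg : AEStronglyMeasurable g)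
    (hg0 : ∀ s, 0 ≤ g s) (hM : ∀ᵐ s, g s ≤ M) (hε : 0 ≤ ε) (hδ : 0 < δ)
    (hmean : ∀ r, 0 < r → r ≤ δ → ∫ s in Metric.ball 0 r, g s ≤ ε * (2 * r))
    (h0 : 0 < y) (hy : y < Real.pi) :
    ∫ s, g s * stripPoisson y s ≤
      ε * (2 * y) + M * (Real.sin y * (2 * (1 + (δ ^ 2)⁻¹)) * Real.pi) := by
  have hM0 : 0 ≤ M := by
    obtain ⟨s, hs⟩ := hM.exists
    exact (hg0 s).trans hs
  have hMabs : ∀ᵐ s, |g s| ≤ M := hM.mono fun s hs => by rwa [abs_of_nonneg (hg0 s)]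
  have hint := integrable_mul_stripPoisson hg hMabs h0.le hy
  have hP := integrable_stripPoisson h0.le hy
  have hP0 := stripPoisson_nonneg h0.le hy
  have hgloc : LocallyIntegrable g := by
    intro x
    refine ⟨Metric.ball x 1, Metric.ball_mem_nhds x one_pos, ?_⟩
    exact Measure.integrableOn_of_bounded (M := M) measure_ball_lt_top.ne hg
      (ae_restrict_of_ae (hMabs.mono fun s hs => hs))
  have hgball : ∀ r, IntegrableOn g (Metric.ball 0 r) := fun r =>
    (hgloc.integrableOn_isCompact (isCompact_closedBall 0 r)).mono_set Metric.ball_subset_closedBall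
  set B : Set ℝ := Metric.ball 0 δ with hB
  have hBm : MeasurableSet B := measurableSet_ball
  have hnear : ∫ s in B, g s * stripPoisson y s ≤ ε * ∫ s in B, stripPoisson y s := by
    have hlin : ∫⁻ s in B, ENNReal.ofReal (g s * stripPoisson y s) ≤
        ENNReal.ofReal ε * ∫⁻ s in B, ENNReal.ofReal (stripPoisson y s) := by
      have hgm : AEMeasurable (fun s => ENNReal.ofReal (g s)) (volume.restrict B) :=
        hg.aemeasurable.ennreal_ofReal.restrict
      have hPm : Measurable (stripPoisson y) :=
        (continuous_stripPoisson (by rwa [abs_of_pos h0])).measurable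
      have e1 : ∫⁻ s in B, ENNReal.ofReal (g s * stripPoisson y s) =
          ∫⁻ s, ENNReal.ofReal (stripPoisson y s)
            ∂((volume.restrict B).withDensity fun s => ENNReal.ofReal (g s)) := by
        rw [lintegral_withDensity_eq_lintegral_mul₀ hgm hPm.ennreal_ofReal.aemeasurable]
        refine lintegral_congr fun s => ?_
        simp [ENNReal.ofReal_mul (hg0 s)]
      have e2 : ENNReal.ofReal ε * ∫⁻ s in B, ENNReal.ofReal (stripPoisson y s) =
          ∫⁻ s, ENNReal.ofReal (stripPoisson y s) ∂(ENNReal.ofReal ε • volume.restrict B) := by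
        rw [lintegral_smul_measure, smul_eq_mul]
      -- Layer-cake formula on both sides: at each level `τ` the measures to compare are those of a
      -- centred ball, which is what `hmean` bounds.
      rw [e1, e2, lintegral_eq_lintegral_meas_lt _ (ae_of_all _ hP0) hPm.aemeasurable,
        lintegral_eq_lintegral_meas_lt _ (ae_of_all _ hP0) hPm.aemeasurable]
      refine setLIntegral_mono' measurableSet_Ioi fun τ hτ => ?_
      obtain ⟨r, hr0, hrδ, hr⟩ := exists_setOf_lt_stripPoisson_inter_ball h0 hy hδ hτ
      have hAm : MeasurableSet {s | τ < stripPoisson y s} := measurableSet_lt measurable_const hPm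
      rw [withDensity_apply _ hAm, Measure.restrict_restrict hAm, hr, Measure.smul_apply,
        Measure.restrict_apply hAm, hr, Real.volume_ball, smul_eq_mul, ← ENNReal.ofReal_mul hε,
        ← ofReal_integral_eq_lintegral_ofReal (hgball r) (ae_of_all _ hg0)]
      rcases hr0.eq_or_lt with rfl | hr0'
      · simp
      · exact ENNReal.ofReal_le_ofReal (hmean r hr0' hrδ)
    rw [← ofReal_integral_eq_lintegral_ofReal hint.integrableOn
      (ae_of_all _ fun s => mul_nonneg (hg0 s) (hP0 s)),
      ← ofReal_integral_eq_lintegral_ofReal hP.integrableOn (ae_of_all _ hP0),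
      ← ENNReal.ofReal_mul hε] at hlin
    exact (ENNReal.ofReal_le_ofReal_iff
      (mul_nonneg hε (integral_nonneg hP0))).1 hlin
  have hnear' : ∫ s in B, stripPoisson y s ≤ 2 * y := by
    rw [← integral_stripPoisson h0.le hy]
    exact setIntegral_le_integral hP (ae_of_all _ hP0)
  have hfar : ∫ s in Bᶜ, g s * stripPoisson y s ≤
      M * (Real.sin y * (2 * (1 + (δ ^ 2)⁻¹)) * Real.pi) := by
    have hsin := Real.sin_nonneg_of_nonneg_of_le_pi h0.le hy.le
    have hI := (integrable_inv_one_add_sq.const_mul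
      (M * (Real.sin y * (2 * (1 + (δ ^ 2)⁻¹)))))
    calc ∫ s in Bᶜ, g s * stripPoisson y s
        ≤ ∫ s in Bᶜ, M * (Real.sin y * (2 * (1 + (δ ^ 2)⁻¹))) * (1 + s ^ 2)⁻¹ := by
          refine setIntegral_mono_ae_restrict hint.integrableOn hI.integrableOn ?_
          filter_upwards [ae_restrict_of_ae hM, ae_restrict_mem hBm.compl] with s h1 h2
          have h3 : δ ≤ |s| := by simpa [hB] using h2
          calc g s * stripPoisson y s
              ≤ M * (Real.sin y * (2 * (1 + (δ ^ 2)⁻¹)) * (1 + s ^ 2)⁻¹) :=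
                mul_le_mul h1 (stripPoisson_le_of_le_abs h0.le hy hδ h3) (hP0 s) hM0
            _ = _ := by ring
      _ ≤ ∫ s, M * (Real.sin y * (2 * (1 + (δ ^ 2)⁻¹))) * (1 + s ^ 2)⁻¹ :=
          setIntegral_le_integral hI (ae_of_all _ fun s => by positivity)
      _ = _ := by rw [integral_const_mul, integral_univ_inv_one_add_sq]; ring
  rw [← integral_add_compl hBm hint]
  refine add_le_add (hnear.trans ?_) hfar
  gcongr

/-- Since the kernel has mass `2y`, the difference is a Poisson integral of `ψ(x - s) - ψ(x)`. The
explicit bound depends on `x` only through `ε` and `δ`, so it serves both at single Lebesgue points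
and uniformly in `x`. -/
theorem abs_stripPotential_im_sub_le {ψ : ℝ → ℝ} {C : ℝ} (hm : AEStronglyMeasurable ψ)
    (hb : ∀ᵐ t, |ψ t| ≤ C) {ε δ x y : ℝ} (hx : |ψ x| ≤ C) (hε : 0 ≤ ε) (hδ : 0 < δ)
    (hmean : ∀ r, 0 < r → r ≤ δ → ∫ t in Metric.ball x r, |ψ t - ψ x| ≤ ε * (2 * r))
    (h0 : 0 < y) (hy : y < Real.pi) :
    |(stripPotential ψ (x + y * Complex.I)).im - y * ψ x| ≤
      1 / 2 * (ε * (2 * y) + (2 * C) * (Real.sin y * (2 * (1 + (δ ^ 2)⁻¹)) * Real.pi)) := by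
  have hw : (x : ℂ) + y * Complex.I ∈ strip := by
    constructor <;> simp <;> linarith [Real.pi_pos]
  have hm' : AEStronglyMeasurable (fun s => ψ (x - s)) :=
    hm.comp_quasiMeasurePreserving (quasiMeasurePreserving_sub_left volume x)
  have hb' : ∀ᵐ s, |ψ (x - s)| ≤ C := (quasiMeasurePreserving_sub_left volume x).ae hb
  have hm'' : AEStronglyMeasurable fun s => |ψ (x - s) - ψ x| :=
    (hm'.sub aestronglyMeasurable_const).norm
  have hb'' : ∀ᵐ s, |ψ (x - s) - ψ x| ≤ 2 * C :=
    hb'.mono fun s hs => (abs_sub _ _).trans (by linarith)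
  have hP0 := stripPoisson_nonneg h0.le hy
  have h1 : (stripPotential ψ (x + y * Complex.I)).im - y * ψ x =
      1 / 2 * ∫ s, (ψ (x - s) - ψ x) * stripPoisson y s := by
    have h2 : ∫ s, (ψ (x - s) - ψ x) * stripPoisson y s =
        (∫ s, ψ (x - s) * stripPoisson y s) - ∫ s, ψ x * stripPoisson y s := by
      simp only [sub_mul]
      exact integral_sub (integrable_mul_stripPoisson hm' hb' h0.le hy)
        ((integrable_stripPoisson h0.le hy).const_mul _)
    rw [stripPotential_im hm hb hw, h2, integral_const_mul, integral_stripPoisson h0.le hy]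
    simp
    ring
  rw [h1, abs_mul, abs_of_pos (by norm_num : (0 : ℝ) < 1 / 2)]
  gcongr
  refine (abs_integral_le_integral_abs).trans ?_
  have h3 : ∀ s, |(ψ (x - s) - ψ x) * stripPoisson y s| = |ψ (x - s) - ψ x| * stripPoisson y s :=
    fun s => by rw [abs_mul, abs_of_nonneg (hP0 s)]
  simp only [h3]
  refine integral_mul_stripPoisson_le hm'' (fun s => abs_nonneg _) hb'' hε hδ (fun r hr hrδ => ?_)
    h0 hy
  refine le_trans (le_of_eq ?_) (hmean r hr hrδ)
  rw [← integral_indicator measurableSet_ball, ← integral_indicator measurableSet_ball,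
    ← integral_sub_left_eq_self _ volume x]
  refine integral_congr_ae (ae_of_all _ fun s => ?_)
  simp only [Set.indicator, Metric.mem_ball, Real.dist_eq]
  congr 1
  · simp [abs_sub_comm]
  · simp

/-- Fatou's theorem for the transform. -/
theorem ae_tendsto_stripPotential_im {ψ : ℝ → ℝ} {C : ℝ} (hm : AEStronglyMeasurable ψ)
    (hb : ∀ᵐ t, |ψ t| ≤ C) : ∀ᵐ x : ℝ, Tendsto
      (fun y : ℝ => (1 / Real.pi) * (stripPotential ψ (x + y * Complex.I)).im) (𝓝[<] Real.pi)
      (𝓝 (ψ x)) := by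
  have hloc : LocallyIntegrable ψ := by
    intro x
    refine ⟨Metric.ball x 1, Metric.ball_mem_nhds x one_pos, ?_⟩
    exact Measure.integrableOn_of_bounded (M := C) measure_ball_lt_top.ne hm
      (ae_restrict_of_ae (hb.mono fun s hs => hs))
  filter_upwards [hb, IsUnifLocDoublingMeasure.ae_tendsto_average_norm_sub volume hloc 1]
    with x hx hL
  have hC : 0 ≤ C := (abs_nonneg _).trans hx
  have hL' := hL (fun _ : ℝ => x) (fun r => r) (l := 𝓝[>] 0) tendsto_id (by
    filter_upwards [self_mem_nhdsWithin] with r hr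
    simp [le_of_lt (Set.mem_Ioi.1 hr)])
  have hmean : ∀ ε > 0, ∃ δ > 0, ∀ r, 0 < r → r ≤ δ →
      ∫ t in Metric.ball x r, |ψ t - ψ x| ≤ ε * (2 * r) := by
    intro ε hε
    have := hL'.eventually (gt_mem_nhds hε)
    rw [eventually_nhdsWithin_iff, Metric.eventually_nhds_iff] at this
    obtain ⟨δ, hδ, h⟩ := this
    refine ⟨δ / 2, by positivity, fun r hr hrδ => ?_⟩
    have h1 := h (y := r) (by rw [Real.dist_eq, sub_zero, abs_of_pos hr]; linarith) hr
    rw [setAverage_eq, measureReal_def, Real.volume_closedBall,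
      ENNReal.toReal_ofReal (by positivity), smul_eq_mul, inv_mul_lt_iff₀ (by positivity)] at h1
    have h2 : IntegrableOn (fun t => ‖ψ t - ψ x‖) (Metric.closedBall x r) :=
      ((hloc.sub (locallyIntegrable_const (ψ x))).integrableOn_isCompact
        (isCompact_closedBall x r)).norm
    have h3 := setIntegral_mono_set h2 (ae_of_all _ fun t => norm_nonneg _)
      (Metric.ball_subset_closedBall (x := x) (ε := r)).eventuallyLE
    simp only [Real.norm_eq_abs] at h3 h1
    linarith
  have hlim : Tendsto (fun y : ℝ => (stripPotential ψ (x + y * Complex.I)).im - y * ψ x)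
      (𝓝[<] Real.pi) (𝓝 0) := by
    rw [Metric.tendsto_nhds]
    intro η hη
    -- With this `ε` the near part of the bound tends to `η/2` as `y → π`, and the far part tends to
    -- `0`.
    obtain ⟨δ, hδ, h⟩ := hmean (η / (2 * Real.pi)) (by positivity)
    have hc : Tendsto (fun y : ℝ => 1 / 2 * ((η / (2 * Real.pi)) * (2 * y) +
        (2 * C) * (Real.sin y * (2 * (1 + (δ ^ 2)⁻¹)) * Real.pi))) (𝓝[<] Real.pi)
        (𝓝 (1 / 2 * ((η / (2 * Real.pi)) * (2 * Real.pi) +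
        (2 * C) * (Real.sin Real.pi * (2 * (1 + (δ ^ 2)⁻¹)) * Real.pi)))) :=
      (Continuous.tendsto (by fun_prop) _).mono_left nhdsWithin_le_nhds
    have hlt : 1 / 2 * ((η / (2 * Real.pi)) * (2 * Real.pi) +
        (2 * C) * (Real.sin Real.pi * (2 * (1 + (δ ^ 2)⁻¹)) * Real.pi)) < η := by
      rw [Real.sin_pi, div_mul_cancel₀ _ (by positivity)]
      linarith
    filter_upwards [hc.eventually (gt_mem_nhds hlt), self_mem_nhdsWithin,
      nhdsWithin_le_nhds (lt_mem_nhds Real.pi_pos)] with y h1 h2 h3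
    rw [Real.dist_eq, sub_zero]
    exact (abs_stripPotential_im_sub_le hm hb hx (by positivity) hδ h h3 h2).trans_lt h1
  have h2 : Tendsto (fun y : ℝ => y * ψ x) (𝓝[<] Real.pi) (𝓝 (Real.pi * ψ x)) :=
    (Continuous.tendsto (by fun_prop) _).mono_left nhdsWithin_le_nhds
  have h3 := (hlim.add h2).const_mul (1 / Real.pi)
  have h4 : 1 / Real.pi * (0 + Real.pi * ψ x) = ψ x := by
    have := Real.pi_pos; field_simp; ring
  rw [h4] at h3
  exact h3.congr fun y => by ring

theorem abs_stripPotential_im_le {ψ : ℝ → ℝ} {C : ℝ} (hm : AEStronglyMeasurable ψ)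
    (hb : ∀ᵐ t, |ψ t| ≤ C) {w : ℂ} (h0 : 0 ≤ w.im) (hy : w.im < Real.pi) :
    |(stripPotential ψ w).im| ≤ C * w.im := by
  have hw : w ∈ strip := ⟨by linarith [Real.pi_pos], hy⟩
  have hb' : ∀ᵐ s, |ψ (w.re - s)| ≤ C := (quasiMeasurePreserving_sub_left volume w.re).ae hb
  have hP0 := stripPoisson_nonneg h0 hy
  have hP := integrable_stripPoisson h0 hy
  have h1 : |∫ s, ψ (w.re - s) * stripPoisson w.im s| ≤ ∫ s, C * stripPoisson w.im s := by
    rw [← Real.norm_eq_abs]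
    refine norm_integral_le_of_norm_le (hP.const_mul C) (hb'.mono fun s hs => ?_)
    rw [Real.norm_eq_abs, abs_mul, abs_of_nonneg (hP0 s)]
    exact mul_le_mul_of_nonneg_right hs (hP0 s)
  rw [integral_const_mul, integral_stripPoisson h0 hy] at h1
  rw [stripPotential_im hm hb hw, abs_mul, abs_of_pos (by norm_num : (0 : ℝ) < 1 / 2)]
  linarith

/-! ### Uniqueness by Phragmén–Lindelöf. -/

/-- An analytic function on a preconnected set is constant if it is real-valued on a nonempty open
subset. -/
theorem eqOn_const_of_im_eq_zero {U V : Set ℂ} {R : ℂ → ℂ} (hR : AnalyticOnNhd ℂ R U)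
    (hU : IsPreconnected U) (hV : IsOpen V) (hVU : V ⊆ U) (hne : V.Nonempty)
    (him : ∀ z ∈ V, (R z).im = 0) : ∃ c, ∀ z ∈ U, R z = c := by
  refine (hR.is_constant_or_isOpen hU).resolve_right fun hopen => ?_
  obtain ⟨z, hz⟩ := hne
  have h1 := (hopen V hVU hV).mem_nhds ⟨z, hz, rfl⟩
  -- An open image would contain `R z + it` for small `t > 0`, which is not real.
  have h2 : Tendsto (fun t : ℝ => R z + t * Complex.I) (𝓝[>] 0) (𝓝 (R z)) := by
    have : Tendsto (fun t : ℝ => R z + t * Complex.I) (𝓝 0) (𝓝 (R z + (0 : ℝ) * Complex.I)) :=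
      Continuous.tendsto (by fun_prop) _
    simp only [Complex.ofReal_zero, zero_mul, add_zero] at this
    exact this.mono_left nhdsWithin_le_nhds
  obtain ⟨t, ⟨v, hv, hvt⟩, ht⟩ := ((h2.eventually h1).and self_mem_nhdsWithin).exists
  have h3 := him v hv
  rw [hvt] at h3
  have h4 := him z hz
  simp [h4] at h3
  exact (ne_of_gt (Set.mem_Ioi.1 ht)) h3

/-- The modulus of `exp(-iR)` is `exp(Im R)`, so this is the maximum principle for that function. It
is bounded by `exp B`, so the growth condition holds trivially. -/
theorem im_le_of_phragmenLindelof {R : ℂ → ℂ} {B ε y : ℝ} (hR : AnalyticOnNhd ℂ R strip)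
    (hB : ∀ w : ℂ, 0 ≤ w.im → w.im < Real.pi → (R w).im ≤ B) (h0 : 0 < y) (hy : y < Real.pi)
    (hbot : ∀ w : ℂ, w.im = 0 → (R w).im ≤ ε) (htop : ∀ w : ℂ, w.im = y → (R w).im ≤ ε) {w : ℂ}
    (hw0 : 0 ≤ w.im) (hwy : w.im ≤ y) : (R w).im ≤ ε := by
  have hnorm : ∀ w, ‖Complex.exp (-Complex.I * R w)‖ = Real.exp (R w).im := fun w => by
    rw [Complex.norm_exp]; simp
  have hsub : closure (Complex.im ⁻¹' Set.Ioo 0 y) ⊆ strip := by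
    refine (closure_minimal (t := Complex.im ⁻¹' Set.Icc 0 y)
      (Set.preimage_mono Set.Ioo_subset_Icc_self)
      (isClosed_Icc.preimage Complex.continuous_im)).trans ?_
    rintro z ⟨h1, h2⟩
    exact ⟨by linarith [Real.pi_pos], by linarith⟩
  have hd : DiffContOnCl ℂ (fun w => Complex.exp (-Complex.I * R w))
      (Complex.im ⁻¹' Set.Ioo 0 y) := by
    apply DifferentiableOn.diffContOnCl
    have := (hR.differentiableOn.mono hsub).const_mul (-Complex.I)
    exact this.cexp
  have hgrow : ∃ c < Real.pi / (y - 0), ∃ B', (fun w => Complex.exp (-Complex.I * R w))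
      =O[comap (abs ∘ Complex.re) atTop ⊓ 𝓟 (Complex.im ⁻¹' Set.Ioo 0 y)] fun z =>
        Real.exp (B' * Real.exp (c * |z.re|)) := by
    refine ⟨0, by simp; positivity, 0, Asymptotics.IsBigO.of_bound (Real.exp B) ?_⟩
    refine Filter.Eventually.filter_mono inf_le_right (eventually_principal.2 fun z hz => ?_)
    rw [hnorm]
    simpa using hB z hz.1.le (hz.2.trans hy)
  have := PhragmenLindelof.horizontal_strip (C := Real.exp ε) hd hgrow
    (fun z hz => by rw [hnorm]; exact Real.exp_le_exp.2 (hbot z hz))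
    (fun z hz => by rw [hnorm]; exact Real.exp_le_exp.2 (htop z hz)) hw0 hwy
  rw [hnorm] at this
  exact Real.exp_le_exp.1 this

/-- Uniqueness: an analytic function on the strip which is real on the real line and whose
imaginary part tends to `0` uniformly at the upper boundary is constant. -/
theorem eqOn_zero_of_im_tendsto_zero {R : ℂ → ℂ} {B : ℝ} (hR : AnalyticOnNhd ℂ R strip)
    (hB : ∀ w : ℂ, 0 ≤ w.im → w.im < Real.pi → |(R w).im| ≤ B)
    (hreal : ∀ w : ℂ, w.im = 0 → (R w).im = 0) (hzero : R 0 = 0)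
    (hlim : ∀ ε > 0, ∀ᶠ y : ℝ in 𝓝[<] Real.pi, ∀ w : ℂ, w.im = y → |(R w).im| ≤ ε) :
    ∀ w ∈ strip, R w = 0 := by
  have hup : ∀ w : ℂ, 0 < w.im → w.im < Real.pi → (R w).im = 0 := by
    intro w hw0 hwpi
    rw [← abs_nonpos_iff]
    refine le_of_forall_pos_le_add fun ε hε => ?_
    rw [zero_add]
    obtain ⟨y, ⟨hy1, hy2⟩, hy3⟩ := (((hlim ε hε).and self_mem_nhdsWithin).and
      (nhdsWithin_le_nhds (lt_mem_nhds hwpi))).exists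
    have hneg : ∀ z, (-R z).im = -(R z).im := fun z => Complex.neg_im _
    rw [abs_le]
    constructor
    · have := im_le_of_phragmenLindelof (R := fun z => -R z) (B := B) (ε := ε) hR.neg
        (fun z h1 h2 => by rw [hneg]; exact (neg_le_abs _).trans (hB z h1 h2))
        (hw0.trans hy3) hy2 (fun z hz => by rw [hneg, hreal z hz]; simpa using hε.le)
        (fun z hz => by rw [hneg]; exact (neg_le_abs _).trans (hy1 z hz)) hw0.le
        (le_of_lt hy3)
      rw [hneg] at this
      linarith
    · exact im_le_of_phragmenLindelof hR (fun z h1 h2 => (le_abs_self _).trans (hB z h1 h2))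
        (hw0.trans hy3) hy2 (fun z hz => by rw [hreal z hz]; exact hε.le)
        (fun z hz => (le_abs_self _).trans (hy1 z hz)) hw0.le (le_of_lt hy3)
  obtain ⟨c, hc⟩ := eqOn_const_of_im_eq_zero (V := {w | 0 < w.im ∧ w.im < Real.pi}) hR
    convex_strip.isPreconnected
    ((isOpen_lt continuous_const Complex.continuous_im).inter
      (isOpen_lt Complex.continuous_im continuous_const))
    (fun z hz => ⟨by linarith [hz.1, Real.pi_pos], hz.2⟩)
    ⟨Complex.I, by simp; linarith [Real.pi_gt_three]⟩ (fun z hz => hup z hz.1 hz.2)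
  intro w hw
  rw [hc w hw, ← hc 0 zero_mem_strip, hzero]

/-! ### Poisson representation of the dilates. -/

theorem exists_forall_norm_sub_le_of_periodic {F : ℂ → ℂ} {p η : ℝ} (hF : AnalyticOnNhd ℂ F strip)
    (hp : 0 < p) (hper : Function.Periodic F (p : ℂ)) (hη : η < Real.pi) {ε : ℝ} (hε : 0 < ε) :
    ∃ δ > 0, ∀ z w : ℂ, 0 ≤ z.im → z.im ≤ η → 0 ≤ w.im → w.im ≤ η → ‖z - w‖ < δ →
      ‖F z - F w‖ ≤ ε := by
  set K : Set ℂ := Set.Icc (-1) (p + 1) ×ℂ Set.Icc 0 η with hK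
  have hKc : IsCompact K := isCompact_Icc.reProdIm isCompact_Icc
  have hKs : K ⊆ strip := fun z hz => by
    rw [Complex.mem_reProdIm] at hz
    exact ⟨by linarith [hz.2.1, Real.pi_pos], by linarith [hz.2.2]⟩
  have huc := hKc.uniformContinuousOn_of_continuous (hF.continuousOn.mono hKs)
  rw [Metric.uniformContinuousOn_iff_le] at huc
  obtain ⟨δ, hδ, h⟩ := huc ε hε
  -- One multiple of `p` translates both points; at distance below `1`, the second stays within the
  -- unit margin of the rectangle `K`.
  refine ⟨min δ 1, by positivity, fun z w hz0 hzη hw0 hwη hzw => ?_⟩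
  obtain ⟨n, hn, -⟩ := existsUnique_sub_zsmul_mem_Ico hp z.re 0
  rw [zero_add, zsmul_eq_mul] at hn
  have hsub : ∀ u : ℂ, F (u - n • (p : ℂ)) = F u := fun u => hper.sub_zsmul_eq n
  rw [← hsub z, ← hsub w, ← dist_eq_norm]
  have hre := (Complex.abs_re_le_norm (z - w)).trans_lt (hzw.trans_le (min_le_right _ _))
  rw [Complex.sub_re, abs_lt] at hre
  refine h _ ?_ _ ?_ ?_
  · rw [hK, Complex.mem_reProdIm]
    refine ⟨⟨?_, ?_⟩, ?_, ?_⟩ <;> simp <;> linarith [hn.1, hn.2]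
  · rw [hK, Complex.mem_reProdIm]
    refine ⟨⟨?_, ?_⟩, ?_, ?_⟩ <;> simp <;> linarith [hn.1, hn.2]
  · rw [dist_eq_norm]
    simpa using (hzw.trans_le (min_le_left _ _)).le

/-- The normalized boundary values at `Im = r π`, rescaled to the line `Im = π`. -/
def dilatedBoundary (F : ℂ → ℂ) (r t : ℝ) : ℝ :=
  (1 / Real.pi) * (F (r * (t + Real.pi * Complex.I))).im

theorem dilate_mem_strip {r : ℝ} (h0 : 0 < r) (h1 : r < 1) {w : ℂ} (hw0 : 0 ≤ w.im)
    (hw : w.im ≤ Real.pi) : (r : ℂ) * w ∈ strip := by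
  have := Real.pi_pos
  constructor
  · simp; nlinarith
  · simp; nlinarith

theorem abs_dilatedBoundary_le {F : ℂ → ℂ}
    (hF : ∀ w : ℂ, 0 ≤ w.im → w.im < Real.pi → |(F w).im| ≤ w.im / 2) {r : ℝ} (h0 : 0 < r)
    (h1 : r < 1) (t : ℝ) : |dilatedBoundary F r t| ≤ 1 / 2 := by
  have hpi := Real.pi_pos
  have h2 := hF (r * (t + Real.pi * Complex.I)) (by simp; positivity) (by simp; nlinarith)
  simp at h2
  rw [dilatedBoundary, abs_mul, abs_of_pos (by positivity), one_div,
    inv_mul_le_iff₀ hpi]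
  nlinarith

theorem continuous_dilatedBoundary {F : ℂ → ℂ} (hF : AnalyticOnNhd ℂ F strip) {r : ℝ} (h0 : 0 < r)
    (h1 : r < 1) : Continuous (dilatedBoundary F r) := by
  have h2 : Continuous fun t : ℝ => F (r * (t + Real.pi * Complex.I)) :=
    hF.continuousOn.comp_continuous (by fun_prop) fun t =>
      dilate_mem_strip h0 h1 (by simp [Real.pi_pos.le]) (by simp)
  exact continuous_const.mul (Complex.continuous_im.comp h2)

/-- Poisson representation of a dilated function of the class. -/
theorem dilate_eq_stripPotential {F : ℂ → ℂ} {p : ℝ} (hF : AnalyticOnNhd ℂ F strip)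
    (him : ∀ w : ℂ, 0 ≤ w.im → w.im < Real.pi → |(F w).im| ≤ w.im / 2) (hzero : F 0 = 0)
    (hp : 0 < p) (hper : Function.Periodic F (p : ℂ)) {r : ℝ} (h0 : 0 < r) (h1 : r < 1) {w : ℂ}
    (hw : w ∈ strip) : F (r * w) = stripPotential (dilatedBoundary F r) w := by
  have hpi := Real.pi_pos
  have hm : AEStronglyMeasurable (dilatedBoundary F r) :=
    (continuous_dilatedBoundary hF h0 h1).aestronglyMeasurable
  have hb : ∀ᵐ t, |dilatedBoundary F r t| ≤ 1 / 2 :=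
    ae_of_all _ (abs_dilatedBoundary_le him h0 h1)
  rw [← sub_eq_zero]
  have himr : ∀ w : ℂ, 0 ≤ w.im → w.im < Real.pi → |(F (r * w)).im| ≤ w.im / 2 := by
    intro w hw0 hw1
    have h2 := him (r * w) (by simp; positivity) (by simp; nlinarith)
    simp at h2
    nlinarith
  refine eqOn_zero_of_im_tendsto_zero
    (R := fun w => F (r * w) - stripPotential (dilatedBoundary F r) w) (B := Real.pi)
    ?_ ?_ ?_ ?_ ?_ w hw
  · refine AnalyticOnNhd.sub ?_ (analyticOnNhd_stripPotential hm hb)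
    refine hF.comp (analyticOnNhd_const.mul analyticOnNhd_id) fun z hz => ?_
    have := hz.1
    have := hz.2
    constructor
    · simp; nlinarith
    · simp; nlinarith
  · intro w hw0 hw1
    rw [Complex.sub_im]
    refine (abs_sub _ _).trans ?_
    linarith [himr w hw0 hw1, abs_stripPotential_im_le hm hb hw0 hw1]
  · intro w hw0
    have h2 := himr w hw0.ge (by rw [hw0]; exact hpi)
    have h3 := abs_stripPotential_im_le hm hb hw0.ge (by rw [hw0]; exact hpi)
    rw [hw0] at h2 h3
    simp only [zero_div, mul_zero, abs_nonpos_iff] at h2 h3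
    rw [Complex.sub_im, h2, h3, sub_zero]
  · simp [hzero, stripPotential_zero]
  · intro ε hε
    have hrpi : r * Real.pi < Real.pi := by nlinarith
    obtain ⟨δ, hδ, hunif⟩ := exists_forall_norm_sub_le_of_periodic hF hp hper hrpi
      (ε := ε / 8) (by positivity)
    have hmean : ∀ x ρ, 0 < ρ → ρ ≤ δ → ∫ t in Metric.ball x ρ,
        |dilatedBoundary F r t - dilatedBoundary F r x| ≤ (ε / 8) * (2 * ρ) := by
      intro x ρ hρ hρδ
      have h3 : ∀ t ∈ Metric.ball x ρ,
          ‖|dilatedBoundary F r t - dilatedBoundary F r x|‖ ≤ ε / 8 := by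
        intro t ht
        rw [Metric.mem_ball, Real.dist_eq] at ht
        have h4 := hunif (r * (t + Real.pi * Complex.I)) (r * (x + Real.pi * Complex.I))
          (by simp; positivity) (by simp) (by simp; positivity) (by simp) (by
            rw [← mul_sub, add_sub_add_right_eq_sub, ← Complex.ofReal_sub, norm_mul,
              Complex.norm_real, Complex.norm_real, Real.norm_eq_abs, Real.norm_eq_abs,
              abs_of_pos h0]
            nlinarith [abs_nonneg (t - x)])
        have h5 := (Complex.abs_im_le_norm _).trans h4
        rw [Complex.sub_im] at h5
        rw [Real.norm_eq_abs, abs_abs, dilatedBoundary, dilatedBoundary, ← mul_sub, abs_mul,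
          abs_of_pos (by positivity), one_div, inv_mul_le_iff₀ hpi]
        nlinarith [Real.pi_gt_three]
      have h4 := norm_setIntegral_le_of_norm_le_const (μ := volume) measure_ball_lt_top h3
      rw [Real.norm_eq_abs, measureReal_def, Real.volume_ball,
        ENNReal.toReal_ofReal (by positivity)] at h4
      exact (le_abs_self _).trans h4
    have hc : Tendsto (fun y : ℝ => 1 / 2 * ((ε / 8) * (2 * y) +
        (2 * (1 / 2)) * (Real.sin y * (2 * (1 + (δ ^ 2)⁻¹)) * Real.pi)) +
        (Real.pi - y) * (1 / 2)) (𝓝[<] Real.pi)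
        (𝓝 (1 / 2 * ((ε / 8) * (2 * Real.pi) +
        (2 * (1 / 2)) * (Real.sin Real.pi * (2 * (1 + (δ ^ 2)⁻¹)) * Real.pi)) +
        (Real.pi - Real.pi) * (1 / 2))) :=
      (Continuous.tendsto (by fun_prop) _).mono_left nhdsWithin_le_nhds
    -- The limit is `πε/8 < ε/2`. The threshold `3ε/4` leaves room for the `ε/8` lost in comparing
    -- `F(rw)` with its value on the boundary line.
    have hlt : 1 / 2 * ((ε / 8) * (2 * Real.pi) +
        (2 * (1 / 2)) * (Real.sin Real.pi * (2 * (1 + (δ ^ 2)⁻¹)) * Real.pi)) +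
        (Real.pi - Real.pi) * (1 / 2) < 3 * ε / 4 := by
      rw [Real.sin_pi]
      nlinarith [Real.pi_lt_four]
    filter_upwards [hc.eventually (gt_mem_nhds hlt), self_mem_nhdsWithin,
      nhdsWithin_le_nhds (lt_mem_nhds hpi),
      nhdsWithin_le_nhds (lt_mem_nhds (show Real.pi - δ < Real.pi by linarith))]
      with y h3 h4 h5 h6 w hwy
    have h4' : y < Real.pi := h4
    have hweq : w = w.re + y * Complex.I := by
      apply Complex.ext <;> simp [hwy]
    have h7 := abs_stripPotential_im_sub_le hm hb (x := w.re)
      (abs_dilatedBoundary_le him h0 h1 _) (by positivity : (0 : ℝ) ≤ ε / 8) hδ (hmean w.re) h5 h4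
    rw [← hweq] at h7
    have h8 := hunif (r * w) (r * (w.re + Real.pi * Complex.I)) (by simp [hwy]; positivity)
      (by simp [hwy]; nlinarith) (by simp; positivity) (by simp) (by
        have : (r : ℂ) * w - r * (w.re + Real.pi * Complex.I) =
            ((r * (y - Real.pi) : ℝ) : ℂ) * Complex.I := by
          conv_lhs => rw [hweq]
          simp; ring
        rw [this, norm_mul, Complex.norm_I, mul_one, Complex.norm_real, Real.norm_eq_abs, abs_mul,
          abs_of_pos h0, abs_of_neg (by linarith)]
        nlinarith)
    have h9 := (Complex.abs_im_le_norm _).trans h8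
    have h10 : (F (r * (w.re + Real.pi * Complex.I))).im =
        Real.pi * dilatedBoundary F r w.re := by
      rw [dilatedBoundary]; field_simp
    rw [Complex.sub_im, h10] at h9
    have h11 : |(Real.pi - y) * dilatedBoundary F r w.re| ≤ (Real.pi - y) * (1 / 2) := by
      rw [abs_mul, abs_of_pos (by linarith)]
      exact mul_le_mul_of_nonneg_left (abs_dilatedBoundary_le him h0 h1 _) (by linarith)
    rw [Complex.sub_im]
    rw [abs_le] at h7 h9 h11 ⊢
    constructor <;> nlinarith [h7.1, h7.2, h9.1, h9.2, h11.1, h11.2]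

/-! ### Weak limits and the representation theorem. -/

theorem memLp_inv_cosh_half_ofReal_sub (x : ℝ) :
    MemLp (fun t : ℝ => (Real.cosh ((x - t) / 2))⁻¹) 2 := by
  refine (memLp_inv_cosh_half_sub (ofReal_mem_strip x)).re.ae_eq (ae_of_all _ fun t => ?_)
  have : ((x : ℂ) - t) / 2 = (((x - t) / 2 : ℝ) : ℂ) := by push_cast; ring
  simp only [this, ← Complex.ofReal_cosh, ← Complex.ofReal_inv]
  simp [-Complex.ofReal_inv, -Complex.ofReal_cosh]

/-- Weak compactness of the ball of `L^∞`, tested against products `φ g` with `g ∈ L²` and a fixed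
positive `φ ∈ L²`. -/
theorem exists_weak_limit {φ : ℝ → ℝ} (hφ : MemLp φ 2) (hφ0 : ∀ t, 0 < φ t)
    {C : ℝ} {ψ : ℝ → ℝ → ℝ} {l : Filter ℝ} [l.NeBot]
    (hm : ∀ᶠ r in l, AEStronglyMeasurable (ψ r)) (hb : ∀ᶠ r in l, ∀ᵐ t, |ψ r t| ≤ C) :
    ∃ (U : Ultrafilter ℝ) (ψ₀ : ℝ → ℝ), ↑U ≤ l ∧ AEStronglyMeasurable ψ₀ ∧
      (∀ᵐ t, |ψ₀ t| ≤ C) ∧ ∀ g : ℝ → ℝ, MemLp g 2 →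
        Tendsto (fun r => ∫ t, ψ r t * (φ t * g t)) U (𝓝 (∫ t, ψ₀ t * (φ t * g t))) := by
  classical
  have hC : 0 ≤ C := by
    obtain ⟨r, hr⟩ := hb.exists
    obtain ⟨t, ht⟩ := hr.exists
    exact (abs_nonneg _).trans ht
  set good : ℝ → Prop := fun r => AEStronglyMeasurable (ψ r) ∧ ∀ᵐ t, |ψ r t| ≤ C with hgood
  have hgl : ∀ᶠ r in l, good r := hm.and hb
  have hmem : ∀ r, good r → MemLp (fun t => ψ r t * φ t) 2 := by
    intro r hr
    refine MemLp.of_le_mul (c := C) hφ (hr.1.mul hφ.1) (hr.2.mono fun t ht => ?_)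
    rw [norm_mul]
    exact mul_le_mul_of_nonneg_right ht (norm_nonneg _)
  -- Multiplication by `φ` moves the bounded functions into a ball of the Hilbert space `L²`, where
  -- Banach–Alaoglu applies through the Riesz isomorphism.
  let Θ : ℝ → Lp ℝ 2 (volume : Measure ℝ) := fun r =>
    if h : good r then (hmem r h).toLp _ else 0
  have hΘ : ∀ r, good r → Θ r =ᵐ[volume] fun t => ψ r t * φ t := by
    intro r hr
    simp only [Θ, dif_pos hr]
    exact MemLp.coeFn_toLp _
  set Φ := hφ.toLp φ with hΦ
  have hΦe : Φ =ᵐ[volume] φ := MemLp.coeFn_toLp _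
  have hbound : ∀ r, ‖Θ r‖ ≤ C * ‖Φ‖ := by
    intro r
    by_cases hr : good r
    · refine Lp.norm_le_mul_norm_of_ae_le_mul ?_
      filter_upwards [hΘ r hr, hΦe, hr.2] with t h1 h2 h3
      rw [h1, h2, norm_mul]
      exact mul_le_mul_of_nonneg_right h3 (norm_nonneg _)
    · simp only [Θ, dif_neg hr, norm_zero]
      positivity
  let T : ℝ → WeakDual ℝ (Lp ℝ 2 (volume : Measure ℝ)) := fun r =>
    StrongDual.toWeakDual (InnerProductSpace.toDual ℝ _ (Θ r))
  set U := Ultrafilter.of l with hU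
  have hUl : ↑U ≤ l := Ultrafilter.of_le l
  obtain ⟨ℓ, -, hℓ⟩ := (WeakDual.isCompact_closedBall (𝕜 := ℝ)
    (0 : StrongDual ℝ (Lp ℝ 2 (volume : Measure ℝ))) (C * ‖Φ‖)).ultrafilter_le_nhds (U.map T) (by
      rw [Ultrafilter.coe_map, le_principal_iff, mem_map]
      refine Filter.univ_mem' fun r => ?_
      simpa [T] using hbound r)
  have hℓt : Tendsto T U (𝓝 ℓ) := hℓ
  set Θ₀ := (InnerProductSpace.toDual ℝ (Lp ℝ 2 (volume : Measure ℝ))).symm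
    (WeakDual.toStrongDual ℓ) with hΘ₀
  have hinner : ∀ g : Lp ℝ 2 (volume : Measure ℝ),
      Tendsto (fun r => inner ℝ (Θ r) g) U (𝓝 (inner ℝ Θ₀ g)) := by
    intro g
    have h1 := ((WeakDual.eval_continuous g).tendsto ℓ).comp hℓt
    have h2 : inner ℝ Θ₀ g = ℓ g := by
      rw [hΘ₀, InnerProductSpace.toDual_symm_apply]; rfl
    rw [h2]
    exact h1
  -- The pointwise bound survives the weak limit: test against indicators of sets of finite measure,
  -- with `σ = ±1` for the two signs.
  have hcomp : ∀ (σ : ℝ), |σ| = 1 → ∀ᵐ t, 0 ≤ C * Φ t - σ * Θ₀ t := by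
    intro σ hσ
    have hint : ∀ (f : Lp ℝ 2 (volume : Measure ℝ)) (s : Set ℝ), volume s < ⊤ →
        IntegrableOn f s := fun f s hs => by
      have : IsFiniteMeasure (volume.restrict s) := ⟨by simpa using hs⟩
      exact ((Lp.memLp f).restrict s).integrable (by norm_num)
    refine ae_nonneg_of_forall_setIntegral_nonneg_of_sigmaFinite
      (fun s _ hμs => ((hint Φ s hμs).const_mul C).sub ((hint Θ₀ s hμs).const_mul σ))
      (fun s hs hμs => ?_)
    have h1 := hinner (indicatorConstLp 2 hs hμs.ne (1 : ℝ))
    have hind : ∀ f : Lp ℝ 2 (volume : Measure ℝ),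
        inner ℝ f (indicatorConstLp 2 hs hμs.ne (1 : ℝ)) = ∫ t in s, f t := fun f => by
      rw [real_inner_comm, L2.inner_indicatorConstLp_one]
    simp only [hind] at h1
    rw [integral_sub ((hint Φ s hμs).const_mul C) ((hint Θ₀ s hμs).const_mul σ), sub_nonneg,
      integral_const_mul, integral_const_mul]
    refine le_of_tendsto (h1.const_mul σ) ((hgl.filter_mono hUl).mono fun r hr => ?_)
    rw [← integral_const_mul, ← integral_const_mul]
    refine setIntegral_mono_ae ((hint (Θ r) s hμs).const_mul σ) ((hint Φ s hμs).const_mul C) ?_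
    filter_upwards [hΘ r hr, hΦe, hr.2] with t h1 h2 h3
    rw [h1, h2, ← mul_assoc]
    refine mul_le_mul_of_nonneg_right (le_trans (le_abs_self _) ?_) (hφ0 t).le
    rwa [abs_mul, hσ, one_mul]
  refine ⟨U, fun t => Θ₀ t / φ t, hUl,
    ((Lp.aestronglyMeasurable Θ₀).aemeasurable.div hφ.1.aemeasurable).aestronglyMeasurable,
    ?_, fun g hg => ?_⟩
  · filter_upwards [hcomp 1 (by simp), hcomp (-1) (by simp), hΦe] with t h1 h2 h3
    rw [h3] at h1 h2
    rw [abs_div, abs_of_pos (hφ0 t), div_le_iff₀ (hφ0 t), abs_le]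
    constructor <;> linarith
  · have h1 := hinner (hg.toLp g)
    have h2 : ∫ t, Θ₀ t / φ t * (φ t * g t) = inner ℝ Θ₀ (hg.toLp g) := by
      rw [L2.inner_def]
      refine integral_congr_ae ?_
      filter_upwards [hg.coeFn_toLp] with t h3
      have := (hφ0 t).ne'
      rw [h3]
      simp
      field_simp
    rw [h2]
    refine h1.congr' ((hgl.filter_mono hUl).mono fun r hr => ?_)
    rw [L2.inner_def]
    refine integral_congr_ae ?_
    filter_upwards [hg.coeFn_toLp, hΘ r hr] with t h3 h4
    rw [h3, h4]
    simp
    ring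

/-- On the real axis the kernel is real and has the form `φ g` used for testing in
`exists_weak_limit`, with `φ(t) = 1/cosh(t/2)`. -/
theorem stripPotential_ofReal (ψ : ℝ → ℝ) (x : ℝ) : stripPotential ψ x =
    ((1 / 2 * ∫ t, ψ t * ((Real.cosh ((0 - t) / 2))⁻¹ *
      (Real.sinh (x / 2) * (Real.cosh ((x - t) / 2))⁻¹)) : ℝ) : ℂ) := by
  rw [stripPotential, Complex.ofReal_mul, ← integral_complex_ofReal]
  congr 1
  · simp
  · refine integral_congr_ae (ae_of_all _ fun t => ?_)
    simp only [stripKernel]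
    push_cast
    rw [zero_sub, neg_div, Complex.cosh_neg]
    field_simp

theorem eqOn_strip_of_eqOn_real {F G : ℂ → ℂ} (hF : AnalyticOnNhd ℂ F strip)
    (hG : AnalyticOnNhd ℂ G strip) (h : ∀ x : ℝ, F x = G x) : Set.EqOn F G strip := by
  refine hF.eqOn_of_preconnected_of_frequently_eq hG convex_strip.isPreconnected zero_mem_strip ?_
  have h1 : Tendsto (fun x : ℝ => (x : ℂ)) (𝓝[≠] 0) (𝓝[≠] 0) := by
    refine tendsto_nhdsWithin_iff.2 ⟨?_, ?_⟩
    · exact (Complex.continuous_ofReal.tendsto' 0 0 (by simp)).mono_left nhdsWithin_le_nhds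
    · filter_upwards [self_mem_nhdsWithin] with x hx
      simpa using hx
  exact h1.frequently (Eventually.of_forall h).frequently

/-- Representation of functions of the class by a bounded function. -/
theorem exists_eqOn_stripPotential {F : ℂ → ℂ} {p : ℝ} (hF : AnalyticOnNhd ℂ F strip)
    (him : ∀ w : ℂ, 0 ≤ w.im → w.im < Real.pi → |(F w).im| ≤ w.im / 2) (hzero : F 0 = 0)
    (hp : 0 < p) (hper : Function.Periodic F (p : ℂ)) :
    ∃ ψ : ℝ → ℝ, AEStronglyMeasurable ψ ∧ (∀ᵐ t, |ψ t| ≤ 1 / 2) ∧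
      Set.EqOn F (stripPotential ψ) strip := by
  have hev : ∀ᶠ r : ℝ in 𝓝[<] 1, 0 < r ∧ r < 1 :=
    Filter.Eventually.and (nhdsWithin_le_nhds (lt_mem_nhds one_pos)) self_mem_nhdsWithin
  obtain ⟨U, ψ, hU, hm, hb, hlim⟩ := exists_weak_limit (memLp_inv_cosh_half_ofReal_sub 0)
    (fun t => inv_pos.2 (Real.cosh_pos _)) (C := 1 / 2) (ψ := dilatedBoundary F) (l := 𝓝[<] 1)
    (hev.mono fun r hr => (continuous_dilatedBoundary hF hr.1 hr.2).aestronglyMeasurable)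
    (hev.mono fun r hr => ae_of_all _ (abs_dilatedBoundary_le him hr.1 hr.2))
  refine ⟨ψ, hm, hb, eqOn_strip_of_eqOn_real hF (analyticOnNhd_stripPotential hm hb) fun x => ?_⟩
  have h1 : Tendsto (fun r : ℝ => stripPotential (dilatedBoundary F r) x) U
      (𝓝 (stripPotential ψ x)) := by
    simp only [stripPotential_ofReal]
    exact (Complex.continuous_ofReal.tendsto _).comp
      ((hlim _ ((memLp_inv_cosh_half_ofReal_sub x).const_mul _)).const_mul _)
  have h2 : Tendsto (fun r : ℝ => F (r * x)) U (𝓝 (F x)) := by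
    have h3 : ContinuousAt F ((1 : ℝ) * x) := by
      rw [Complex.ofReal_one, one_mul]; exact (hF _ (ofReal_mem_strip x)).continuousAt
    have h4 : ContinuousAt (fun r : ℝ => F (r * x)) 1 :=
      ContinuousAt.comp (f := fun r : ℝ => (r : ℂ) * x) h3 (by fun_prop)
    have h5 := h4.tendsto
    simp only [Complex.ofReal_one, one_mul] at h5
    exact h5.mono_left (hU.trans nhdsWithin_le_nhds)
  refine tendsto_nhds_unique (h2.congr' ?_) h1
  filter_upwards [hU hev] with r hr
  exact dilate_eq_stripPotential hF him hzero hp hper hr.1 hr.2 (ofReal_mem_strip x)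

/-! ### The bijection between bounded functions and functions on the strip. -/

theorem extendZero_of_mem {U : Set ℂ} (S : U → ℂ) {w : ℂ} (hw : w ∈ U) :
    extendZero S w = S ⟨w, hw⟩ :=
  Subtype.val_injective.extend_apply S 0 (⟨w, hw⟩ : U)

theorem extendZero_of_notMem {U : Set ℂ} (S : U → ℂ) {w : ℂ} (hw : w ∉ U) :
    extendZero S w = 0 :=
  Function.extend_apply' _ _ _ fun ⟨a, ha⟩ => hw (ha ▸ a.2)

theorem ae_abs_le_of_norm_le {Ψ : RealLInfty} {C : ℝ} (h : ‖Ψ‖ ≤ C) : ∀ᵐ t, |Ψ t| ≤ C := by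
  have h1 : ∀ᵐ t, ‖Ψ t‖ ≤ ‖Ψ‖ := by
    have h2 := ae_le_eLpNormEssSup (f := Ψ) (μ := (volume : Measure ℝ))
    filter_upwards [h2] with t ht
    rw [Lp.norm_def, eLpNorm_exponent_top]
    rw [← ENNReal.ofReal_le_iff_le_toReal
      (by rw [← eLpNorm_exponent_top]; exact Lp.eLpNorm_ne_top Ψ), ofReal_norm]
    exact ht
  exact h1.mono fun t ht => ht.trans h

theorem stripIntegrand_eq (Ψ : RealLInfty) (w : ℂ) (t : ℝ) :
    stripIntegrand Ψ w t = (Ψ t : ℂ) * stripKernel w t :=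
  mul_div_assoc _ _ _

theorem stripTransform_apply (Ψ : RealLInfty) (w : strip) :
    stripTransform Ψ w = stripPotential Ψ w := by
  simp only [stripTransform, stripPotential, stripIntegrand_eq]

theorem IsWFunction.congr {p : ℝ} {F G : ℂ → ℂ} (hG : IsWFunction p G) (h : Set.EqOn F G strip) :
    IsWFunction p F where
  analytic := hG.analytic.congr isOpen_strip h.symm
  abs_im_le w h0 h1 := by
    rw [h ⟨by linarith [Real.pi_pos], h1⟩]; exact hG.abs_im_le w h0 h1
  map_zero := by rw [h zero_mem_strip, hG.map_zero]
  even w hw := by rw [h hw, h (neg_mem_strip hw), hG.even w hw]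
  periodic w hw := by rw [h hw, h (add_ofReal_mem_strip hw p), hG.periodic w hw]

theorem isWFunction_stripPotential {p : ℝ} {ψ : ℝ → ℝ} (hm : AEStronglyMeasurable ψ)
    (hb : ∀ᵐ t, |ψ t| ≤ 1 / 2) (ho : ∀ᵐ t, ψ (-t) = -ψ t) (hp : ∀ᵐ t, ψ (t + p) = ψ t) :
    IsWFunction p (stripPotential ψ) where
  analytic := analyticOnNhd_stripPotential hm hb
  abs_im_le w h0 h1 := (abs_stripPotential_im_le hm hb h0 h1).trans_eq (by ring)
  map_zero := stripPotential_zero ψ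
  even w _ := stripPotential_neg ho w
  periodic _ hw := stripPotential_add_period hm hb ho hp hw

theorem eqOn_extendZero_stripTransform (Ψ : RealLInfty) :
    Set.EqOn (extendZero (stripTransform Ψ)) (stripPotential Ψ) strip := fun w hw => by
  rw [extendZero_of_mem _ hw, stripTransform_apply]

theorem isWFunction_of_mem_ball {p : ℝ} {Ψ : RealLInfty} (hΨ : Ψ ∈ oddPeriodicHalfBall p) :
    IsWFunction p (stripPotential Ψ) :=
  isWFunction_stripPotential (Lp.aestronglyMeasurable Ψ) (ae_abs_le_of_norm_le hΨ.2.2) hΨ.1 hΨ.2.1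

theorem stripTransform_mem {p : ℝ} {Ψ : RealLInfty} (hΨ : Ψ ∈ oddPeriodicHalfBall p) :
    stripTransform Ψ ∈ WClass p :=
  (isWFunction_of_mem_ball hΨ).congr (eqOn_extendZero_stripTransform Ψ)

theorem stripPotential_conj (ψ : ℝ → ℝ) (w : ℂ) :
    stripPotential ψ (starRingEnd ℂ w) = starRingEnd ℂ (stripPotential ψ w) := by
  simp only [stripPotential, map_mul, ← integral_conj]
  congr 1
  · simp [map_ofNat (starRingEnd ℂ) 2]
  · refine integral_congr_ae (ae_of_all _ fun t => ?_)
    simp [stripKernel, map_ofNat (starRingEnd ℂ) 2, ← Complex.cosh_conj, ← Complex.sinh_conj]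

theorem vertical_mem_strip (t : ℝ) {y : ℝ} (h0 : 0 < y) (hy : y < Real.pi) :
    (t : ℂ) + y * Complex.I ∈ strip := by
  constructor <;> simp <;> linarith [Real.pi_pos]

theorem eventually_mem_Ioo_zero_pi : ∀ᶠ y : ℝ in 𝓝[<] Real.pi, 0 < y ∧ y < Real.pi :=
  Filter.Eventually.and (nhdsWithin_le_nhds (lt_mem_nhds Real.pi_pos)) self_mem_nhdsWithin

/-- Evenness combined with conjugation symmetry shows that the reflection `w ↦ -conj w`, which fixes
heights, changes the sign of `Im F`. Boundary limits at `t` and `-t` then give oddness. -/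
theorem ae_odd_of_even {p : ℝ} {F : ℂ → ℂ} (hF : IsWFunction p F) {ψ : ℝ → ℝ} {C : ℝ}
    (hm : AEStronglyMeasurable ψ) (hb : ∀ᵐ t, |ψ t| ≤ C)
    (h : Set.EqOn F (stripPotential ψ) strip) : ∀ᵐ t, ψ (-t) = -ψ t := by
  have hlim := ae_tendsto_stripPotential_im hm hb
  filter_upwards [hlim, (quasiMeasurePreserving_neg volume).ae hlim] with t h1 h2
  refine tendsto_nhds_unique h2 (h1.neg.congr' ?_)
  filter_upwards [eventually_mem_Ioo_zero_pi] with y hy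
  have hw := vertical_mem_strip t hy.1 hy.2
  have h3 : ((-t : ℝ) : ℂ) + y * Complex.I = -(starRingEnd ℂ ((t : ℂ) + y * Complex.I)) := by
    simp [add_comm]
  have h4 : stripPotential ψ (((-t : ℝ) : ℂ) + y * Complex.I) =
      starRingEnd ℂ (stripPotential ψ ((t : ℂ) + y * Complex.I)) := by
    rw [← stripPotential_conj, h3]
    have hc : starRingEnd ℂ ((t : ℂ) + y * Complex.I) ∈ strip := by
      have h5 := hw.1
      have h6 := hw.2
      constructor <;> rw [Complex.conj_im] <;> linarith
    rw [← h hc, ← h (neg_mem_strip hc), hF.even _ hc]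
  rw [h4, Complex.conj_im]
  ring

theorem ae_periodic_of_periodic {p : ℝ} {F : ℂ → ℂ} (hF : IsWFunction p F) {ψ : ℝ → ℝ} {C : ℝ}
    (hm : AEStronglyMeasurable ψ) (hb : ∀ᵐ t, |ψ t| ≤ C)
    (h : Set.EqOn F (stripPotential ψ) strip) : ∀ᵐ t, ψ (t + p) = ψ t := by
  have hlim := ae_tendsto_stripPotential_im hm hb
  filter_upwards [hlim, (measurePreserving_add_right volume p).quasiMeasurePreserving.ae hlim]
    with t h1 h2
  refine tendsto_nhds_unique h2 (h1.congr' ?_)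
  filter_upwards [eventually_mem_Ioo_zero_pi] with y hy
  have hw := vertical_mem_strip t hy.1 hy.2
  have h3 : ((t + p : ℝ) : ℂ) + y * Complex.I = (t : ℂ) + y * Complex.I + p := by
    push_cast; ring
  rw [h3, ← h hw, ← h (add_ofReal_mem_strip hw p), hF.periodic _ hw]

theorem periodic_extendZero {p : ℝ} {S : strip → ℂ} (hS : S ∈ WClass p) :
    Function.Periodic (extendZero S) (p : ℂ) := by
  intro w
  by_cases hw : w ∈ strip
  · exact hS.periodic w hw
  · rw [extendZero_of_notMem S hw, extendZero_of_notMem S fun h => hw ?_]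
    have := add_ofReal_mem_strip h (-p)
    simpa using this

theorem bijOn_stripTransform {p : ℝ} (hp : 0 < p) :
    Set.BijOn stripTransform (oddPeriodicHalfBall p) (WClass p) := by
  refine ⟨fun Ψ hΨ => stripTransform_mem hΨ, fun Ψ₁ h₁ Ψ₂ h₂ h => ?_, fun S hS => ?_⟩
  · apply Lp.ext
    filter_upwards [ae_tendsto_stripPotential_im (Lp.aestronglyMeasurable Ψ₁)
      (ae_abs_le_of_norm_le h₁.2.2), ae_tendsto_stripPotential_im (Lp.aestronglyMeasurable Ψ₂)
      (ae_abs_le_of_norm_le h₂.2.2)] with t h3 h4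
    refine tendsto_nhds_unique h3 (h4.congr' ?_)
    filter_upwards [eventually_mem_Ioo_zero_pi] with y hy
    have := congrFun h ⟨_, vertical_mem_strip t hy.1 hy.2⟩
    rw [stripTransform_apply, stripTransform_apply] at this
    rw [this]
  · obtain ⟨ψ, hm, hb, hψ⟩ := exists_eqOn_stripPotential hS.analytic hS.abs_im_le hS.map_zero hp
      (periodic_extendZero hS)
    have ho := ae_odd_of_even hS hm hb hψ
    have hper := ae_periodic_of_periodic hS hm hb hψ
    have hL : MemLp ψ ⊤ := memLp_top_of_bound hm (1 / 2) hb
    have he := hL.coeFn_toLp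
    refine ⟨hL.toLp ψ, ⟨?_, ?_, ?_⟩, ?_⟩
    · filter_upwards [ho, he, (quasiMeasurePreserving_neg volume).ae he] with t h1 h2 h3
      rw [h2, h3, h1]
    · filter_upwards [hper, he,
        (measurePreserving_add_right volume p).quasiMeasurePreserving.ae he] with t h1 h2 h3
      rw [h2, h3, h1]
    · rw [Lp.norm_toLp, eLpNorm_exponent_top]
      refine ENNReal.toReal_le_of_le_ofReal (by norm_num) ?_
      exact eLpNormEssSup_le_of_ae_bound hb
    · funext w
      rw [stripTransform_apply, ← extendZero_of_mem S w.2, hψ w.2]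
      simp only [stripPotential]
      congr 1
      refine integral_congr_ae ?_
      filter_upwards [he] with t ht
      rw [ht]

theorem integrable_stripIntegrand {p : ℝ} {Ψ : RealLInfty} (hΨ : Ψ ∈ oddPeriodicHalfBall p) {w : ℂ}
    (hw : w ∈ strip) : Integrable (stripIntegrand Ψ w) :=
  (integrable_ofReal_mul (Lp.aestronglyMeasurable Ψ) (ae_abs_le_of_norm_le hΨ.2.2)
    (integrable_stripKernel hw)).congr (ae_of_all _ fun t => (stripIntegrand_eq Ψ w t).symm)

theorem ae_tendsto_im_of_stripTransform_eq {p : ℝ} {S : strip → ℂ} {Ψ : RealLInfty}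
    (hΨ : Ψ ∈ oddPeriodicHalfBall p) (h : stripTransform Ψ = S) :
    ∀ᵐ t : ℝ, Tendsto
      (fun μ : ℝ => (1 / Real.pi) * (extendZero S ((t : ℂ) + (μ : ℂ) * Complex.I)).im)
      (𝓝[<] Real.pi) (𝓝 (Ψ t)) := by
  subst h
  filter_upwards [ae_tendsto_stripPotential_im (Lp.aestronglyMeasurable Ψ)
    (ae_abs_le_of_norm_le hΨ.2.2)] with t ht
  refine ht.congr' ?_
  filter_upwards [eventually_mem_Ioo_zero_pi] with y hy
  rw [eqOn_extendZero_stripTransform Ψ (vertical_mem_strip t hy.1 hy.2)]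

/-! ### Molnár functions in the logarithmic coordinate. -/

theorem exp_mem_slitPlane_of_mem_strip {w : ℂ} (hw : w ∈ strip) :
    Complex.exp w ∈ Complex.slitPlane := by
  rw [Complex.mem_slitPlane_iff_arg]
  refine ⟨?_, Complex.exp_ne_zero w⟩
  rw [← Complex.log_im, Complex.log_exp hw.1 hw.2.le]
  exact hw.2.ne

theorem log_mem_strip {z : ℂ} (hz : z ∈ Complex.slitPlane) : Complex.log z ∈ strip := by
  rw [Complex.mem_slitPlane_iff_arg] at hz
  exact ⟨by rw [Complex.log_im]; exact Complex.neg_pi_lt_arg z,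
    by rw [Complex.log_im]; exact lt_of_le_of_ne (Complex.arg_le_pi z) hz.1⟩

theorem log_exp_of_mem_strip {w : ℂ} (hw : w ∈ strip) : Complex.log (Complex.exp w) = w :=
  Complex.log_exp hw.1 hw.2.le

theorem conj_mem_strip {w : ℂ} (hw : w ∈ strip) : starRingEnd ℂ w ∈ strip := by
  have h1 := hw.1
  have h2 := hw.2
  constructor <;> rw [Complex.conj_im] <;> linarith

theorem isOMPlus_congr {F G : ℂ → ℂ} (hG : IsOMPlus G) (h : Set.EqOn F G Complex.slitPlane) :
    IsOMPlus F where
  analytic := hG.analytic.congr Complex.isOpen_slitPlane h.symm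
  nonneg x hx := by
    rw [h (Complex.ofReal_mem_slitPlane.2 hx)]; exact hG.nonneg x hx
  im_nonneg z hz := by
    rw [h (Or.inr hz.ne')]; exact hG.im_nonneg z hz

theorem IsMolnarFunction.congr {c : ℝ} (hc : 0 < c) {F G : ℂ → ℂ} (hG : IsMolnarFunction c G)
    (h : Set.EqOn F G Complex.slitPlane) : IsMolnarFunction c F where
  omPlus := isOMPlus_congr hG.omPlus h
  map_one := by rw [h Complex.one_mem_slitPlane, hG.map_one]
  symm x hx := by
    rw [h (Complex.ofReal_mem_slitPlane.2 (one_div_pos.2 hx)),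
      h (Complex.ofReal_mem_slitPlane.2 hx), hG.symm x hx]
  scaling x hx := by
    rw [h (Complex.ofReal_mem_slitPlane.2 (by positivity)),
      h (Complex.ofReal_mem_slitPlane.2 hx), hG.scaling x hx]

theorem conj_symm_of_real {G : ℂ → ℂ} (hG : AnalyticOnNhd ℂ G strip)
    (hr : ∀ x : ℝ, (G x).im = 0) {w : ℂ} (hw : w ∈ strip) :
    G (starRingEnd ℂ w) = starRingEnd ℂ (G w) := by
  have h1 : AnalyticOnNhd ℂ (starRingEnd ℂ ∘ G ∘ starRingEnd ℂ) strip := by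
    refine DifferentiableOn.analyticOnNhd (fun z hz => ?_) isOpen_strip
    have h2 := (hG _ (conj_mem_strip hz)).differentiableAt.conj_conj
    rw [Complex.conj_conj] at h2
    exact h2.differentiableWithinAt
  have h2 := eqOn_strip_of_eqOn_real hG h1 (fun x => by
    simp only [Function.comp, Complex.conj_ofReal]
    exact (Complex.conj_eq_iff_im.2 (hr x)).symm) (conj_mem_strip hw)
  simpa using h2

theorem exp_im_pos {w : ℂ} (h0 : 0 < w.im) (h1 : w.im < Real.pi) : 0 < (Complex.exp w).im := by
  rw [Complex.exp_im]
  exact mul_pos (Real.exp_pos _) (Real.sin_pos_of_pos_of_lt_pi h0 h1)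

section

variable {c : ℝ} {F : ℂ → ℂ}

theorem IsMolnarFunction.analyticOnNhd_comp_exp (hF : IsMolnarFunction c F) :
    AnalyticOnNhd ℂ (fun w => F (Complex.exp w)) strip :=
  hF.omPlus.analytic.comp (fun w _ => Complex.differentiable_exp.analyticAt w)
    fun _ hw => exp_mem_slitPlane_of_mem_strip hw

theorem IsMolnarFunction.comp_exp_ofReal (hF : IsMolnarFunction c F) (x : ℝ) :
    0 ≤ (F (Complex.exp x)).re ∧ (F (Complex.exp x)).im = 0 := by
  rw [← Complex.ofReal_exp]
  exact hF.omPlus.nonneg _ (Real.exp_pos x)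

/-- By the open mapping theorem a real value in the upper half strip would force nearby values with
negative imaginary part. Constants are excluded by `F(1) = 1` and `F(c²) = c ≠ 1`. -/
theorem IsMolnarFunction.comp_exp_im_pos (hF : IsMolnarFunction c F) (hc : 1 < c) {w : ℂ}
    (h0 : 0 < w.im) (h1 : w.im < Real.pi) : 0 < (F (Complex.exp w)).im := by
  have hw : w ∈ strip := ⟨by linarith [Real.pi_pos], h1⟩
  have hnonneg : ∀ z : ℂ, 0 < z.im → z.im < Real.pi → 0 ≤ (F (Complex.exp z)).im :=
    fun z hz0 hz1 => hF.omPlus.im_nonneg _ (exp_im_pos hz0 hz1)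
  rcases hF.analyticOnNhd_comp_exp.is_constant_or_isOpen convex_strip.isPreconnected with
    ⟨a, ha⟩ | hopen
  · have h2 := ha 0 zero_mem_strip
    have h3 := ha _ (ofReal_mem_strip (Real.log (c ^ 2)))
    rw [← Complex.ofReal_exp, Real.exp_log (by positivity)] at h3
    have h4 := hF.scaling 1 one_pos
    rw [mul_one, h3, Complex.ofReal_one, hF.map_one, mul_one] at h4
    simp only [Complex.exp_zero, hF.map_one] at h2
    rw [← h2] at h4
    exact absurd (by exact_mod_cast h4.symm) hc.ne'
  · by_contra hneg
    have h2 : (F (Complex.exp w)).im = 0 := le_antisymm (not_lt.1 hneg) (hnonneg w h0 h1)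
    have hVo : IsOpen {z : ℂ | 0 < z.im ∧ z.im < Real.pi} :=
      (isOpen_lt continuous_const Complex.continuous_im).inter
        (isOpen_lt Complex.continuous_im continuous_const)
    have h3 := (hopen _ (fun z hz => ⟨by linarith [hz.1, Real.pi_pos], hz.2⟩) hVo).mem_nhds
      ⟨w, ⟨h0, h1⟩, rfl⟩
    have h4 : Tendsto (fun t : ℝ => F (Complex.exp w) - t * Complex.I) (𝓝[>] 0)
        (𝓝 (F (Complex.exp w))) :=
      (Continuous.tendsto' (by fun_prop) _ _ (by simp)).mono_left nhdsWithin_le_nhds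
    obtain ⟨t, ⟨v, hv, hvt⟩, ht⟩ := ((h4.eventually h3).and self_mem_nhdsWithin).exists
    have h5 := hnonneg v hv.1 hv.2
    have hvt' : F (Complex.exp v) = F (Complex.exp w) - t * Complex.I := hvt
    rw [hvt'] at h5
    simp [h2] at h5
    exact absurd h5 (not_le.2 ht)

theorem IsMolnarFunction.comp_exp_im_neg (hF : IsMolnarFunction c F) (hc : 1 < c) {w : ℂ}
    (h0 : w.im < 0) (h1 : -Real.pi < w.im) : (F (Complex.exp w)).im < 0 := by
  have hw : w ∈ strip := ⟨h1, by linarith [Real.pi_pos]⟩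
  have h2 := hF.comp_exp_im_pos hc (w := starRingEnd ℂ w) (by simpa using h0)
    (by rw [Complex.conj_im]; linarith)
  rw [conj_symm_of_real hF.analyticOnNhd_comp_exp (fun x => (hF.comp_exp_ofReal x).2) hw,
    Complex.conj_im] at h2
  linarith

/-- At a zero, openness would produce negative real values. None occurs off the real axis, where the
imaginary part is nonzero, nor on it, where `F ≥ 0`. -/
theorem IsMolnarFunction.comp_exp_ofReal_pos (hF : IsMolnarFunction c F) (hc : 1 < c) (x : ℝ) :
    0 < (F (Complex.exp x)).re := by
  refine lt_of_le_of_ne (hF.comp_exp_ofReal x).1 fun h => ?_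
  have hzero : F (Complex.exp x) = 0 :=
    Complex.ext h.symm (hF.comp_exp_ofReal x).2
  rcases hF.analyticOnNhd_comp_exp.is_constant_or_isOpen convex_strip.isPreconnected with
    ⟨a, ha⟩ | hopen
  · have h2 := ha 0 zero_mem_strip
    have h3 := ha _ (ofReal_mem_strip x)
    rw [hzero] at h3
    simp only [Complex.exp_zero, hF.map_one] at h2
    rw [← h3] at h2
    exact one_ne_zero h2
  · have h3 := (hopen _ subset_rfl isOpen_strip).mem_nhds ⟨x, ofReal_mem_strip x, rfl⟩
    have h4 : Tendsto (fun t : ℝ => F (Complex.exp x) - t) (𝓝[>] 0) (𝓝 (F (Complex.exp x))) :=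
      (Continuous.tendsto' (by fun_prop) _ _ (by simp)).mono_left nhdsWithin_le_nhds
    obtain ⟨t, ⟨v, hv, hvt⟩, ht⟩ := ((h4.eventually h3).and self_mem_nhdsWithin).exists
    have hvt' : F (Complex.exp v) = F (Complex.exp x) - t := hvt
    rw [hzero, zero_sub] at hvt'
    rcases lt_trichotomy v.im 0 with h5 | h5 | h5
    · have := hF.comp_exp_im_neg hc h5 hv.1
      rw [hvt'] at this
      simp at this
    · have h6 : v = (v.re : ℂ) := Complex.ext (by simp) (by simp [h5])
      have := (hF.comp_exp_ofReal v.re).1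
      rw [← h6, hvt'] at this
      simp at this
      exact absurd this (not_le.2 ht)
    · have := hF.comp_exp_im_pos hc h5 hv.2
      rw [hvt'] at this
      simp at this

theorem IsMolnarFunction.comp_exp_mem_slitPlane (hF : IsMolnarFunction c F) (hc : 1 < c) {w : ℂ}
    (hw : w ∈ strip) : F (Complex.exp w) ∈ Complex.slitPlane := by
  rcases lt_trichotomy w.im 0 with h | h | h
  · exact Or.inr (hF.comp_exp_im_neg hc h hw.1).ne
  · have h6 : w = (w.re : ℂ) := Complex.ext (by simp) (by simp [h])
    rw [h6]
    exact Or.inl (hF.comp_exp_ofReal_pos hc _)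
  · exact Or.inr (hF.comp_exp_im_pos hc h hw.2).ne'

/-- The logarithm of a Molnár function in the logarithmic coordinate. -/
theorem IsMolnarFunction.isWFunction_log {p : ℝ} (hF : IsMolnarFunction c F) (hc : 1 < c)
    (hp : p = 2 * Real.log c) :
    IsWFunction p fun w => Complex.log (F (Complex.exp w)) - w / 2 := by
  have han : AnalyticOnNhd ℂ (fun w => Complex.log (F (Complex.exp w)) - w / 2) strip :=
    (hF.analyticOnNhd_comp_exp.clog fun w hw => hF.comp_exp_mem_slitPlane hc hw).sub
      (analyticOnNhd_id.div analyticOnNhd_const fun _ _ => two_ne_zero)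
  have hcoe : ∀ x : ℝ, F (Complex.exp x) = ((F (Complex.exp x)).re : ℂ) := fun x =>
    Complex.ext (by simp) (by simp [(hF.comp_exp_ofReal x).2])
  have hlog : ∀ x : ℝ, Complex.log (F (Complex.exp x)) =
      (Real.log (F (Complex.exp x)).re : ℂ) := fun x => by
    rw [Complex.ofReal_log (hF.comp_exp_ofReal_pos hc x).le, ← hcoe]
  have hpos := hF.comp_exp_ofReal_pos hc
  -- The logarithm of `x F(1/x) = F(x)` on the real axis, extended by the identity theorem;
  -- periodicity below comes from scaling likewise.
  have heven : ∀ w ∈ strip, Complex.log (F (Complex.exp (-w))) - (-w) / 2 =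
      Complex.log (F (Complex.exp w)) - w / 2 := by
    refine eqOn_strip_of_eqOn_real
      (F := fun w => Complex.log (F (Complex.exp (-w))) - (-w) / 2)
      (han.comp analyticOnNhd_id.neg fun w hw => neg_mem_strip hw) han fun x => ?_
    have h1 := hF.symm (Real.exp x) (Real.exp_pos x)
    rw [one_div, ← Real.exp_neg, Complex.ofReal_exp, Complex.ofReal_exp, hcoe (-x), hcoe x,
      ← Complex.ofReal_exp] at h1
    have h2 : Real.exp x * (F (Complex.exp (-x : ℝ))).re = (F (Complex.exp x)).re := by
      exact_mod_cast h1
    have h3 := congrArg Real.log h2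
    rw [Real.log_mul (Real.exp_pos x).ne' (hpos _).ne', Real.log_exp] at h3
    have h4 := hlog (-x)
    rw [Complex.ofReal_neg] at h4
    rw [h4, hlog x, ← h3]
    push_cast
    ring
  have hlower : ∀ w : ℂ, 0 < w.im → w.im < Real.pi →
      0 ≤ (Complex.log (F (Complex.exp w))).im := fun w h0 h1 => by
    rw [Complex.log_im]
    exact Complex.arg_nonneg_iff.2 (hF.comp_exp_im_pos hc h0 h1).le
  have hupper : ∀ w : ℂ, w.im < 0 → -Real.pi < w.im →
      (Complex.log (F (Complex.exp w))).im ≤ 0 := fun w h0 h1 => by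
    rw [Complex.log_im]
    exact (Complex.arg_neg_iff.2 (hF.comp_exp_im_neg hc h0 h1)).le
  have hhalf : ∀ w : ℂ, (w / 2).im = w.im / 2 := fun w => by simp
  refine ⟨han, fun w h0 h1 => ?_, by simp [hF.map_one], heven, ?_⟩
  · rcases h0.eq_or_lt with h | h
    · have h6 : w = (w.re : ℂ) := Complex.ext (by simp) (by simp [← h])
      rw [Complex.sub_im, hhalf, h6, hlog]
      simp
    · have h2 := heven w ⟨by linarith [Real.pi_pos], h1⟩
      have h3 := hlower w h h1
      have h4 := hupper (-w) (by simpa using h) (by simpa using h1)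
      have h5 := congrArg Complex.im h2
      simp only [Complex.sub_im, hhalf, Complex.neg_im] at h5 ⊢
      rw [abs_le]
      constructor <;> linarith
  · refine eqOn_strip_of_eqOn_real
      (F := fun w => Complex.log (F (Complex.exp (w + p))) - (w + p) / 2)
      (han.comp (analyticOnNhd_id.add analyticOnNhd_const)
        fun w hw => add_ofReal_mem_strip hw p) han fun x => ?_
    have h1 := hF.scaling (Real.exp x) (Real.exp_pos x)
    have h2 : c ^ 2 * Real.exp x = Real.exp (x + p) := by
      rw [Real.exp_add, hp, mul_comm 2, Real.exp_mul, Real.exp_log (by positivity), mul_comm]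
      norm_num
    rw [h2, Complex.ofReal_exp, Complex.ofReal_exp, hcoe (x + p), hcoe x] at h1
    have h3 : (F (Complex.exp (x + p : ℝ))).re = c * (F (Complex.exp x)).re := by
      exact_mod_cast h1
    have h4 := hlog (x + p)
    rw [h3, Real.log_mul (by positivity) (hpos _).ne', Complex.ofReal_add] at h4
    rw [h4, hlog x, hp]
    push_cast
    ring

end

/-- The inverse of the logarithmic correspondence. -/
def molnarOf (F : ℂ → ℂ) (z : ℂ) : ℂ :=
  Complex.exp (Complex.log z / 2) * Complex.exp (F (Complex.log z))

section

variable {p : ℝ} {F : ℂ → ℂ}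

theorem IsWFunction.im_ofReal (hF : IsWFunction p F) (x : ℝ) : (F x).im = 0 := by
  have := hF.abs_im_le x (by simp) (by simp [Real.pi_pos])
  simpa using this

theorem IsWFunction.abs_im_le_abs (hF : IsWFunction p F) {w : ℂ} (hw : w ∈ strip) :
    |(F w).im| ≤ |w.im| / 2 := by
  rcases le_total 0 w.im with h | h
  · rw [abs_of_nonneg h]; exact hF.abs_im_le w h hw.2
  · have := hF.abs_im_le (-w) (by simpa using h) (by have := hw.1; simp; linarith)
    rwa [hF.even w hw, Complex.neg_im, ← abs_of_nonpos h] at this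

/-- The bound gives `|Im(w/2 + F(w))| ≤ |Im w| < π`, so the principal logarithm undoes the
exponential. -/
theorem IsWFunction.log_molnarOf_exp (hF : IsWFunction p F) {w : ℂ} (hw : w ∈ strip) :
    Complex.log (molnarOf F (Complex.exp w)) - w / 2 = F w := by
  have h1 := hF.abs_im_le_abs hw
  have h2 : |w.im| < Real.pi := abs_lt.2 hw
  have h3 : |(w / 2 + F w).im| < Real.pi := by
    rw [Complex.add_im]
    refine (abs_add_le _ _).trans_lt ?_
    have : |(w / 2).im| = |w.im| / 2 := by simp [abs_div]
    linarith
  rw [molnarOf, log_exp_of_mem_strip hw, ← Complex.exp_add,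
    log_exp_of_mem_strip (abs_lt.1 h3)]
  ring

theorem molnarOf_ofReal (hF : IsWFunction p F) {x : ℝ} (hx : 0 < x) :
    molnarOf F x =
      ((Real.exp (Real.log x / 2) * Real.exp (F (Real.log x)).re : ℝ) : ℂ) := by
  have h1 : F (Real.log x) = ((F (Real.log x)).re : ℂ) :=
    Complex.ext (by simp) (by simp only [hF.im_ofReal, Complex.ofReal_im])
  rw [molnarOf, ← Complex.ofReal_log hx.le, h1]
  push_cast
  rfl

theorem IsWFunction.isMolnarFunction_molnarOf {c : ℝ} (hF : IsWFunction p F) (hc : 1 < c)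
    (hp : p = 2 * Real.log c) : IsMolnarFunction c (molnarOf F) where
  omPlus :=
    { analytic := by
        have hlog : AnalyticOnNhd ℂ Complex.log Complex.slitPlane :=
          fun z hz => analyticAt_clog hz
        refine AnalyticOnNhd.mul ?_ ?_
        · exact (hlog.div analyticOnNhd_const fun _ _ => two_ne_zero).cexp
        · exact (hF.analytic.comp hlog fun z hz => log_mem_strip hz).cexp
      nonneg := fun x hx => by
        rw [molnarOf_ofReal hF hx, Complex.ofReal_re, Complex.ofReal_im]
        exact ⟨by positivity, rfl⟩
      im_nonneg := fun z hz => by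
        have hs := log_mem_strip (Or.inr hz.ne')
        have h0 : 0 ≤ (Complex.log z).im := by
          rw [Complex.log_im]; exact Complex.arg_nonneg_iff.2 hz.le
        -- The exponent has imaginary part between `0` and `Im log z < π`, where sine is
        -- nonnegative.
        have h1 := abs_le.1 (hF.abs_im_le _ h0 hs.2)
        rw [molnarOf, ← Complex.exp_add, Complex.exp_im]
        refine mul_nonneg (Real.exp_pos _).le (Real.sin_nonneg_of_nonneg_of_le_pi ?_ ?_)
        · rw [Complex.add_im]; simp only [Complex.div_ofNat_im]; linarith [h1.1]
        · rw [Complex.add_im]; simp only [Complex.div_ofNat_im]; linarith [h1.2, hs.2] }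
  map_one := by simp [molnarOf, hF.map_zero]
  symm x hx := by
    rw [molnarOf_ofReal hF hx, molnarOf_ofReal hF (one_div_pos.2 hx), one_div, Real.log_inv,
      Complex.ofReal_neg, hF.even _ (ofReal_mem_strip _), ← Complex.ofReal_mul]
    congr 1
    rw [← mul_assoc]
    congr 1
    nth_rewrite 1 [← Real.exp_log hx]
    rw [← Real.exp_add]
    ring_nf
  scaling x hx := by
    have hc0 : 0 < c := by linarith
    have h1 : Real.log (c ^ 2 * x) = Real.log x + p := by
      rw [Real.log_mul (by positivity) hx.ne', Real.log_pow, hp]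
      push_cast
      ring
    rw [molnarOf_ofReal hF hx, molnarOf_ofReal hF (by positivity), h1, Complex.ofReal_add,
      hF.periodic _ (ofReal_mem_strip _), ← Complex.ofReal_mul]
    congr 1
    rw [← mul_assoc]
    congr 1
    nth_rewrite 1 [← Real.exp_log hc0]
    rw [← Real.exp_add, hp]
    ring_nf

end

theorem bijOn_logTransform {p c : ℝ} (hc : 1 < c) (hp : p = 2 * Real.log c) :
    Set.BijOn logTransform (MolnarClass c) (WClass p) := by
  refine ⟨fun f hf => ?_, fun f hf g hg h => ?_, fun S hS => ?_⟩
  · exact (IsMolnarFunction.isWFunction_log hf hc hp).congr fun w hw =>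
      extendZero_of_mem _ hw
  · funext z
    have h1 := congrFun h ⟨_, log_mem_strip z.2⟩
    have hz := Complex.exp_log (Complex.slitPlane_ne_zero z.2)
    have hf0 := Complex.slitPlane_ne_zero (IsMolnarFunction.comp_exp_mem_slitPlane hf hc
      (log_mem_strip z.2))
    have hg0 := Complex.slitPlane_ne_zero (IsMolnarFunction.comp_exp_mem_slitPlane hg hc
      (log_mem_strip z.2))
    simp only [logTransform, sub_left_inj, hz] at h1 hf0 hg0
    have h2 := congrArg Complex.exp h1
    rw [Complex.exp_log hf0, Complex.exp_log hg0, extendZero_of_mem f z.2,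
      extendZero_of_mem g z.2] at h2
    exact h2
  · refine ⟨fun z => molnarOf (extendZero S) z, ?_, ?_⟩
    · exact (IsWFunction.isMolnarFunction_molnarOf hS hc hp).congr (by linarith)
        fun z hz => extendZero_of_mem _ hz
    · funext w
      rw [logTransform, extendZero_of_mem _ (exp_mem_slitPlane_of_mem_strip w.2),
        IsWFunction.log_molnarOf_exp hS w.2, extendZero_of_mem S w.2]

/-! ### The explicit formula on the slit plane. -/

/-- Each factor `1 + e^a` equals `2 e^{a/2} cosh(a/2)`, and the exponentials multiply to `e^{w/2}`.
Multiplying by `e^w - 1 = 2 e^{w/2} sinh(w/2)` then leaves half of `stripKernel`. -/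
theorem slitIntegrand_exp (Ψ : RealLInfty) (w : ℂ) (t : ℝ) :
    slitIntegrand Ψ (Complex.exp w) t = (Ψ t : ℂ) * ((4 * Complex.exp (w / 2))⁻¹ *
      (Complex.cosh ((t : ℂ) / 2) * Complex.cosh ((w - t) / 2))⁻¹) := by
  have h1 : (1 + Complex.exp t) = 2 * Complex.exp (t / 2) * Complex.cosh ((t : ℂ) / 2) := by
    rw [Complex.cosh, show (t : ℂ) = t / 2 + t / 2 by ring, Complex.exp_add, Complex.exp_neg]
    have := Complex.exp_ne_zero ((t : ℂ) / 2)
    ring_nf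
    field_simp
  have h2 : 1 + Complex.exp (-t) * Complex.exp w =
      2 * Complex.exp ((w - t) / 2) * Complex.cosh ((w - t) / 2) := by
    rw [← Complex.exp_add, Complex.cosh, show -(t : ℂ) + w = (w - t) / 2 + (w - t) / 2 by ring,
      Complex.exp_add, Complex.exp_neg]
    have := Complex.exp_ne_zero ((w - t) / 2)
    field_simp
    ring
  have h3 : Complex.exp (w / 2) = Complex.exp (t / 2) * Complex.exp ((w - t) / 2) := by
    rw [← Complex.exp_add]; ring_nf
  rw [slitIntegrand, h1, h2, h3, ← mul_inv, div_eq_mul_inv]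
  ring_nf

theorem integrable_slitIntegrand {p : ℝ} {Ψ : RealLInfty} (hΨ : Ψ ∈ oddPeriodicHalfBall p) {z : ℂ}
    (hz : z ∈ Complex.slitPlane) : Integrable (slitIntegrand Ψ z) := by
  rw [← Complex.exp_log (Complex.slitPlane_ne_zero hz)]
  exact (integrable_ofReal_mul (Lp.aestronglyMeasurable Ψ) (ae_abs_le_of_norm_le hΨ.2.2)
    ((integrable_inv_cosh_mul_cosh (log_mem_strip hz)).const_mul _)).congr
    (ae_of_all _ fun t => (slitIntegrand_exp Ψ _ t).symm)

theorem molnarTransform_apply (Ψ : RealLInfty) (z : Complex.slitPlane) :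
    molnarTransform Ψ z = molnarOf (stripPotential Ψ) z := by
  have hz := Complex.exp_log (Complex.slitPlane_ne_zero z.2)
  set w := Complex.log z with hw
  have h1 : ((z : ℂ) - 1) * ∫ t : ℝ, slitIntegrand Ψ z t = stripPotential Ψ w := by
    rw [← hz, stripPotential, ← integral_const_mul, ← integral_const_mul]
    refine integral_congr_ae (ae_of_all _ fun t => ?_)
    have h2 : Complex.exp w - 1 = 2 * Complex.exp (w / 2) * Complex.sinh (w / 2) := by
      have h0 := Complex.exp_ne_zero (w / 2)
      nth_rewrite 1 [show w = w / 2 + w / 2 by ring]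
      rw [Complex.exp_add, Complex.sinh, Complex.exp_neg]
      field_simp
    have h3 := Complex.exp_ne_zero (w / 2)
    have h4 := cosh_half_ofReal_ne_zero t
    have h5 := cosh_half_sub_ne_zero (log_mem_strip z.2) t
    rw [← hw] at h5
    simp only [slitIntegrand_exp, h2, stripKernel]
    field_simp
    ring
  rw [molnarTransform, molnarOf, h1]

theorem logTransform_molnarTransform {p : ℝ} {Ψ : RealLInfty} (hΨ : Ψ ∈ oddPeriodicHalfBall p) :
    logTransform (molnarTransform Ψ) = stripTransform Ψ := by
  funext w
  rw [logTransform, extendZero_of_mem _ (exp_mem_slitPlane_of_mem_strip w.2),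
    molnarTransform_apply, (isWFunction_of_mem_ball hΨ).log_molnarOf_exp w.2,
    stripTransform_apply]

/-- Two out of three: `logTransform ∘ molnarTransform = stripTransform` on the ball, and the other
two maps are bijections. -/
theorem bijOn_molnarTransform {p c : ℝ} (hp0 : 0 < p) (hc : 1 < c) (hp : p = 2 * Real.log c) :
    Set.BijOn molnarTransform (oddPeriodicHalfBall p) (MolnarClass c) := by
  have hmaps : Set.MapsTo molnarTransform (oddPeriodicHalfBall p) (MolnarClass c) := fun Ψ hΨ =>
    ((isWFunction_of_mem_ball hΨ).isMolnarFunction_molnarOf hc hp).congr (by linarith)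
      fun z hz => by rw [extendZero_of_mem _ hz, molnarTransform_apply]
  refine ⟨hmaps, fun Ψ₁ h₁ Ψ₂ h₂ h => ?_, fun f hf => ?_⟩
  · refine (bijOn_stripTransform hp0).injOn h₁ h₂ ?_
    rw [← logTransform_molnarTransform h₁, ← logTransform_molnarTransform h₂, h]
  · obtain ⟨Ψ, hΨ, h⟩ := (bijOn_stripTransform hp0).surjOn ((bijOn_logTransform hc hp).mapsTo hf)
    exact ⟨Ψ, hΨ, (bijOn_logTransform hc hp).injOn (hmaps hΨ) hf
      (by rw [logTransform_molnarTransform hΨ, h])⟩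

end

theorem theorem3p2 (p : ℝ) (hp : 0 < p) :
    -- the integral defining `S` converges for each `w ∈ D`
    (∀ Ψ ∈ oddPeriodicHalfBall p, ∀ w ∈ strip, Integrable (stripIntegrand Ψ w)) ∧
    -- `S` belongs to `𝒲_p`
    (∀ Ψ ∈ oddPeriodicHalfBall p, stripTransform Ψ ∈ WClass p) ∧
    -- `Ψ ↦ S` is a bijection onto `𝒲_p`
    Set.BijOn stripTransform (oddPeriodicHalfBall p) (WClass p) ∧
    -- recovery of `Ψ` from `S`
    (∀ S ∈ WClass p, ∀ Ψ ∈ oddPeriodicHalfBall p, stripTransform Ψ = S →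
      ∀ᵐ t : ℝ, Tendsto
        (fun μ : ℝ => (1 / Real.pi) * (extendZero S ((t : ℂ) + (μ : ℂ) * Complex.I)).im)
        (𝓝[<] Real.pi) (𝓝 (Ψ t))) ∧
    -- the parametrization of the Molnár functions of type `c`, where `p = 2 log c`
    (∀ c : ℝ, 1 < c → p = 2 * Real.log c →
      Set.BijOn logTransform (MolnarClass c) (WClass p) ∧
      (∀ Ψ ∈ oddPeriodicHalfBall p, ∀ z ∈ Complex.slitPlane, Integrable (slitIntegrand Ψ z)) ∧
      (∀ Ψ ∈ oddPeriodicHalfBall p, logTransform (molnarTransform Ψ) = stripTransform Ψ) ∧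
      Set.BijOn molnarTransform (oddPeriodicHalfBall p) (MolnarClass c)) := by
  refine ⟨fun Ψ hΨ w hw => integrable_stripIntegrand hΨ hw, fun Ψ hΨ => stripTransform_mem hΨ,
    bijOn_stripTransform hp, fun S _ Ψ hΨ h => ae_tendsto_im_of_stripTransform_eq hΨ h,
    fun c hc hpc => ⟨bijOn_logTransform hc hpc, fun Ψ hΨ z hz => integrable_slitIntegrand hΨ hz,
      fun Ψ hΨ => logTransform_molnarTransform hΨ, bijOn_molnarTransform hp hc hpc⟩⟩
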